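/- Theorem (RMSE bound for the optimal value of MLMC-SAA). Let $d\in\mathbb N$, $D,L_f,H\in\mathbb R$, $a\in(0,\infty)$, $c_2\ge 0$ and $\beta>0$. There is a constant $\bar{\mathfrak c}>0$, depending only on $d,D,L_f,a,c_2,\beta,H$, with the following property. Let $\mathcal X\subset\mathbb R^d$ be a nonempty compact set of Euclidean diameter at most $D$, let $\zeta,\zeta_0,\dots,\zeta_L$, $L\ge 2$, be random variables on a probability space $(\Omega,\mathcal F,\mathbb P)$ with values in a measurable space $\Theta$ (for instance a Borel subset of $\mathbb R^s$), and let $f\colon\mathcal X\times\Theta\to\mathbb R$ be measurable in its second argument, with $f(x,\zeta)$ integrable for every $x\in\mathcal X$. Let $0<h_\ell\le H$ for $0\le\ell\le L$, let $\alpha>0$ and $c_1\in\mathbb R$, put $f(x,\zeta_{-1})\equiv 0$, and assume 1. (Lipschitz) $|f(x_1,z)-f(x_2,z)|\le L_f\|x_1-x_2\|$ for all $x_1,x_2\in\mathcal X$ and $z\in\Theta$; 2. (bias) $\sup_{x\in\mathcal X}|\mathbb E[f(x,\zeta_\ell)-f(x,\zeta)]|\le c_1h_\ell^{\alpha}$ for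 $0\le\ell\le L$; 3. (variance) $\mathbb E\big[\sup_{x\in\mathcal X}|f(x,\zeta_\ell)-f(x,\zeta_{\ell-1})|^2\big]\le c_2h_\ell^{\beta}$ for $0\le\ell\le L$. For each level $0\le\ell\le L$ let $N_\ell\ge 1$ and let $(\zeta_\ell^k,\zeta_{\ell-1}^k)$, $1\le k\le N_\ell$, be i.i.d. copies of $(\zeta_\ell,\zeta_{\ell-1})$ (of $\zeta_0$ alone if $\ell=0$), with no assumption on the dependence between levels. Put $$\mathfrak p^*=\min_{x\in\mathcal X}\mathbb E[f(x,\zeta)],\qquad \hat{\mathfrak p}^{*,L}=\min_{x\in\mathcal X}\sum_{\ell=0}^L\frac1{N_\ell}\sum_{k=1}^{N_\ell}\big(f(x,\zeta_\ell^k)-f(x,\zeta_{\ell-1}^k)\big).$$ Then $\hat{\mathfrak p}^{*,L}-\mathfrak p^*$ is square-integrable and, with $\bar\beta=\beta/(1+a)$ and $\|Y\|_2=(\mathbb E|Y|^2)^{1/2}$, $$\big\|\hat{\mathfrak p}^{*,L}-\mathfrak p^*\big\|_2\;\le\; c_1h_L^{\alpha}+2c_2\,\bar{\mathfrak c}\sum_{\ell=0}^L\frac{h_\ell^{\bar\beta/2}}{\sqrt{N_\ell}}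 .$$ -/

import Mathlib

open MeasureTheory ProbabilityTheory
open scoped ENNReal

noncomputable section

namespace MLMCSAA

/-- The decision space `ℝ^d` with its Euclidean norm. -/
abbrev Dec (d : ℕ) : Type := EuclideanSpace ℝ (Fin d)

variable {d : ℕ} {Θ Ω : Type*}

/-- The expected cost `F(x) = 𝔼[f(x, ζ)]`. -/
def expectedCost [MeasurableSpace Ω] (P : Measure Ω) (f : Dec d → Θ → ℝ) (ζ : Ω → Θ)
    (x : Dec d) : ℝ :=
  ∫ ω, f x (ζ ω) ∂P

/-- The optimal value `p* = min_{x ∈ X} 𝔼[f(x, ζ)]`. The infimum is a minimum whenever `X` is a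
nonempty compact set on which the objective is continuous. -/
def optimalValue [MeasurableSpace Ω] (P : Measure Ω) (X : Set (Dec d)) (f : Dec d → Θ → ℝ)
    (ζ : Ω → Θ) : ℝ :=
  ⨅ x : X, expectedCost P f ζ x

/-- The level-`ℓ` increment `g_ℓ(x, (z, w)) = f(x, z) - f(x, w)`, where `z` is the fine and `w` the
coarse argument. On level `0` there is no coarse argument: `g_0(x, (z, w)) = f(x, z)`, which is the
convention `f(x, ζ_{-1}) ≡ 0`. -/
def increment (f : Dec d → Θ → ℝ) (ℓ : ℕ) (x : Dec d) (p : Θ × Θ) : ℝ :=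
  f x p.1 - if ℓ = 0 then 0 else f x p.2

/-- The multilevel sample average
`∑_{ℓ=0}^{L} (1/N_ℓ) ∑_{k=1}^{N_ℓ} (f(x, ζ_ℓ^k) - f(x, ζ_{ℓ-1}^k))`, where
`Z ℓ k = (ζ_ℓ^k, ζ_{ℓ-1}^k)` is the `k`-th sample on level `ℓ`. -/
def mlmcObjective (f : Dec d → Θ → ℝ) (L : ℕ) (N : ℕ → ℕ) (Z : ℕ → ℕ → Ω → Θ × Θ)
    (x : Dec d) (ω : Ω) : ℝ :=
  ∑ ℓ ∈ Finset.range (L + 1), (1 / (N ℓ : ℝ)) *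
    ∑ k ∈ Finset.range (N ℓ), increment f ℓ x (Z ℓ k ω)

/-- The (random) optimal value of the MLMC-SAA problem: the minimum over `X` of the multilevel
sample average. -/
def mlmcOptimalValue (X : Set (Dec d)) (f : Dec d → Θ → ℝ) (L : ℕ) (N : ℕ → ℕ)
    (Z : ℕ → ℕ → Ω → Θ × Θ) (ω : Ω) : ℝ :=
  ⨅ x : X, mlmcObjective f L N Z x ω

/-- `f(·, z)` is Lipschitz on `X` with constant `Lf`, for every `z`. -/
def LipschitzCost (X : Set (Dec d)) (f : Dec d → Θ → ℝ) (Lf : ℝ) : Prop :=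
  ∀ z : Θ, ∀ x₁ ∈ X, ∀ x₂ ∈ X, |f x₁ z - f x₂ z| ≤ Lf * ‖x₁ - x₂‖

/-- Bias on level `ℓ`: `sup_{x ∈ X} |𝔼[f(x, ζ_ℓ) - f(x, ζ)]| ≤ b`. -/
def BiasBound [MeasurableSpace Ω] (P : Measure Ω) (X : Set (Dec d)) (f : Dec d → Θ → ℝ)
    (ζ : Ω → Θ) (ζs : ℕ → Ω → Θ) (ℓ : ℕ) (b : ℝ) : Prop :=
  ∀ x ∈ X, |∫ ω, (f x (ζs ℓ ω) - f x (ζ ω)) ∂P| ≤ b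

/-- `V_ℓ = 𝔼[sup_{x ∈ X} |f(x, ζ_ℓ) - f(x, ζ_{ℓ-1})|²]`, with values in `[0, ∞]`. For `ℓ = 0` the
increment ignores its second argument, so `V_0 = 𝔼[sup_{x ∈ X} |f(x, ζ_0)|²]`. -/
def levelVariance [MeasurableSpace Ω] (P : Measure Ω) (X : Set (Dec d)) (f : Dec d → Θ → ℝ)
    (ζs : ℕ → Ω → Θ) (ℓ : ℕ) : ℝ≥0∞ :=
  ∫⁻ ω, ⨆ x : X, ‖increment f ℓ x (ζs ℓ ω, ζs (ℓ - 1) ω)‖ₑ ^ 2 ∂P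

/-- `Z ℓ k`, `k < N ℓ`, are i.i.d. copies of the pair `(ζ_ℓ, ζ_{ℓ-1})`, on every level
`1 ≤ ℓ ≤ L`; on level `0` the first components are i.i.d. copies of `ζ_0` (the second components
are irrelevant). Nothing is assumed about the dependence between different levels. -/
structure IsMLMCSample [MeasurableSpace Ω] [MeasurableSpace Θ] (P : Measure Ω)
    (ζs : ℕ → Ω → Θ) (L : ℕ) (N : ℕ → ℕ) (Z : ℕ → ℕ → Ω → Θ × Θ) : Prop where
  indep_zero : iIndepFun (fun (k : Fin (N 0)) ω => (Z 0 k ω).1) P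
  law_zero : ∀ k < N 0, IdentDistrib (fun ω => (Z 0 k ω).1) (ζs 0) P P
  indep : ∀ ℓ, 1 ≤ ℓ → ℓ ≤ L → iIndepFun (fun k : Fin (N ℓ) => Z ℓ k) P
  law : ∀ ℓ, 1 ≤ ℓ → ℓ ≤ L → ∀ k < N ℓ,
    IdentDistrib (Z ℓ k) (fun ω => (ζs ℓ ω, ζs (ℓ - 1) ω)) P P

end MLMCSAA

end

/-!
The error of the optimal value is at most the supremum over `X` of the error of the objective, and
the objective error splits into the bias at the finest level, which is at most `c₁ * h L ^ α`, and
one centred sample average for each level. By Minkowski's inequality it remains to bound the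
root-mean-square of the supremum over `X` of each centred average by a constant times
`h ℓ ^ (β / (1 + a) / 2) / √(N ℓ)`; no independence between levels is involved. Suprema over `X` are
taken along a dense sequence, which settles all questions of measurability.

For one level (`exists_lintegral_iSup_centered_le`), let `S` be the envelope `sup_x |g x|` of the
increment `g`, with `𝔼[S²] ≤ v = c₂ * h ℓ ^ β`. Interpolating between the Lipschitz bound and the
bound `2 * S` makes `g` Hölder of exponent `θ = a / (1 + a)` in `x`, with a random constant whose
second moment is of order `v ^ κ`, where `κ = 1 / (1 + a)`. Symmetrization replaces the centred sum
by a sum with random signs of differences of independent copies, and with the sample held fixed the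
signed sum is a Rademacher process. By Khintchine's inequality (`sum_signedSum_pow_le`) *all* its
even moments are controlled by the sum of the squared coefficients, so chaining over dyadic nets of
`X` with a sufficiently high moment (`exists_chaining_majorant`) converges for every `θ > 0`. This
bounds the second moment of the supremum by a constant times the sum of the squared Hölder constants
and of the squared values at one point (`exists_signedSum_majorant`), and integrating over the
sample gives `N * C * (v ^ κ + v)`. The bound `h ℓ ≤ H` absorbs `v` into `h ℓ ^ (β * κ)`. If `c₂ = 0`, the
estimate holds for every `v > 0`, and `v` tends to `0`.
-/

namespace MLMCSAA

/-! ### Khintchine's inequality -/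

/-- The sign `±1` encoded by a Boolean: `true` is `1` and `false` is `-1`. -/
def boolSign (b : Bool) : ℝ := if b then 1 else -1

/-- The signed sum `∑ₖ εₖ vₖ` for the sign pattern `ε`. Averages over all `ε : ι → Bool` play the
role of expectations over independent Rademacher variables. -/
def signedSum {ι : Type*} [Fintype ι] (ε : ι → Bool) (v : ι → ℝ) : ℝ :=
  ∑ k, boolSign (ε k) * v k

section Khintchine

variable {ι : Type*} [Fintype ι]

lemma signedSum_neg (ε : ι → Bool) (v : ι → ℝ) :
    signedSum ε (fun k => -v k) = -signedSum ε v := by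
  simp [signedSum]

lemma signedSum_sub (ε : ι → Bool) (v w : ι → ℝ) :
    signedSum ε (fun k => v k - w k) = signedSum ε v - signedSum ε w := by
  simp [signedSum, mul_sub]

lemma signedSum_smul (ε : ι → Bool) (c : ℝ) (v : ι → ℝ) :
    signedSum ε (fun k => c * v k) = c * signedSum ε v := by
  simp only [signedSum, Finset.mul_sum]
  exact Finset.sum_congr rfl fun k _ => by ring

lemma sum_exp_signedSum_le [DecidableEq ι] (v : ι → ℝ) :
    ∑ ε : ι → Bool, Real.exp (signedSum ε v) ≤
      2 ^ Fintype.card ι * Real.exp ((∑ k, v k ^ 2) / 2) := by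
  have h1 : ∑ ε : ι → Bool, Real.exp (signedSum ε v) = ∏ k, (2 * Real.cosh (v k)) := by
    have : ∀ k, 2 * Real.cosh (v k) = ∑ b : Bool, Real.exp (boolSign b * v k) := by
      intro k
      rw [Real.cosh_eq]
      simp [boolSign]
      ring
    simp_rw [this, Finset.prod_univ_sum, signedSum, Real.exp_sum, Fintype.piFinset_univ]
  rw [h1, Finset.prod_mul_distrib, Finset.prod_const, Finset.card_univ]
  gcongr
  rw [Finset.sum_div, Real.exp_sum]
  exact Finset.prod_le_prod (fun k _ => (Real.cosh_pos _).le) fun k _ => Real.cosh_le_exp_half_sq _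

/-- Khintchine's inequality for even moments: the `2q`-th moment of a Rademacher sum is bounded by
the `2q`-th power of the Euclidean norm of its coefficients. After normalisation it follows from
`t ^ (2 * q) ≤ (2 * q)! * (exp t + exp (-t))` and the sub-Gaussian exponential moment. -/
lemma sum_signedSum_pow_le [DecidableEq ι] (q : ℕ) (hq : q ≠ 0) (v : ι → ℝ) (s : ℝ) (hs : 0 ≤ s)
    (hv : ∑ k, v k ^ 2 ≤ s ^ 2) :
    ∑ ε : ι → Bool, signedSum ε v ^ (2 * q) ≤
      2 ^ Fintype.card ι * (2 * (2 * q).factorial * Real.exp (1 / 2)) * s ^ (2 * q) := by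
  rcases hs.eq_or_lt with rfl | hs
  · have h0 : ∀ k, v k = 0 := by
      intro k
      have := Finset.single_le_sum (f := fun k => v k ^ 2) (fun k _ => sq_nonneg _)
        (Finset.mem_univ k)
      have h2 : v k ^ 2 ≤ 0 := by
        have := this.trans hv
        simpa using this
      exact pow_eq_zero_iff (two_ne_zero) |>.1 (le_antisymm h2 (sq_nonneg _))
    have : 2 * q ≠ 0 := by omega
    simp [signedSum, h0, this]
  have key : ∀ t : ℝ, t ^ (2 * q) ≤ (2 * q).factorial * (Real.exp t + Real.exp (-t)) := by
    intro t
    have h1 := Real.pow_div_factorial_le_exp |t| (abs_nonneg t) (2 * q)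
    rw [div_le_iff₀ (by positivity), pow_mul, sq_abs, ← pow_mul] at h1
    have h2 : Real.exp |t| ≤ Real.exp t + Real.exp (-t) := by
      rcases abs_choice t with h | h <;> rw [h] <;> linarith [Real.exp_pos t, Real.exp_pos (-t)]
    calc t ^ (2 * q) ≤ Real.exp |t| * (2 * q).factorial := h1
      _ ≤ (Real.exp t + Real.exp (-t)) * (2 * q).factorial := by gcongr
      _ = _ := by ring
  set w : ι → ℝ := fun k => s⁻¹ * v k with hw
  have hvw : v = fun k => s * w k := by
    funext k; simp only [hw]; field_simp
  have hw1 : ∑ k, w k ^ 2 ≤ 1 := by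
    have : ∑ k, w k ^ 2 = (∑ k, v k ^ 2) / s ^ 2 := by
      rw [Finset.sum_div]
      exact Finset.sum_congr rfl fun k _ => by simp only [hw]; field_simp
    rw [this, div_le_one (by positivity)]
    exact hv
  have e1 : ∑ ε : ι → Bool, Real.exp (signedSum ε w) ≤
      2 ^ Fintype.card ι * Real.exp (1 / 2) := by
    refine (sum_exp_signedSum_le w).trans ?_
    gcongr
  have e2 : ∑ ε : ι → Bool, Real.exp (-signedSum ε w) ≤
      2 ^ Fintype.card ι * Real.exp (1 / 2) := by
    simp_rw [← signedSum_neg]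
    refine (sum_exp_signedSum_le _).trans ?_
    simp only [neg_sq]
    gcongr
  have hsum : ∑ ε : ι → Bool, signedSum ε w ^ (2 * q) ≤
      2 ^ Fintype.card ι * (2 * (2 * q).factorial * Real.exp (1 / 2)) := by
    calc ∑ ε : ι → Bool, signedSum ε w ^ (2 * q)
        ≤ ∑ ε : ι → Bool, ((2 * q).factorial : ℝ) *
            (Real.exp (signedSum ε w) + Real.exp (-signedSum ε w)) :=
          Finset.sum_le_sum fun ε _ => key _
      _ = ((2 * q).factorial : ℝ) * (∑ ε : ι → Bool, Real.exp (signedSum ε w) +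
            ∑ ε : ι → Bool, Real.exp (-signedSum ε w)) := by
          rw [← Finset.mul_sum, Finset.sum_add_distrib]
      _ ≤ ((2 * q).factorial : ℝ) * (2 ^ Fintype.card ι * Real.exp (1 / 2) +
            2 ^ Fintype.card ι * Real.exp (1 / 2)) := by gcongr
      _ = _ := by ring
  rw [hvw]
  simp_rw [signedSum_smul, mul_pow]
  rw [← Finset.mul_sum, mul_comm]
  gcongr

end Khintchine

/-! ### Chaining -/

/-- Multiscale approximation of a bounded sequence of points of `ℝ^d` by finitely many of its
members: at scale `2⁻ʲ` at most `(3 · 2ʲ) ^ d` of them suffice, and at scale `1` the initial point alone. The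
approximants are representatives of the cells of a cubic grid. -/
lemma exists_dyadic_net (d : ℕ) (D : ℝ) :
    ∃ R : ℝ, 0 < R ∧ ∀ x : ℕ → Dec d, (∀ n m, dist (x n) (x m) ≤ D) →
      ∃ (ρ : ℕ → ℕ → ℕ) (F : ℕ → Finset ℕ), (∀ n, ρ 0 n = 0) ∧ (∀ j n, ρ j n ∈ F j) ∧
        (∀ j, (F j).card ≤ (3 * 2 ^ j) ^ d) ∧
        ∀ j n, dist (x n) (x (ρ j n)) ≤ R * (1 / 2) ^ j := by
  classical
  set T : ℝ := |D| + 1 with hT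
  have hTpos : 0 < T := by positivity
  refine ⟨(√d + 1) * T, by positivity, fun x hx => ?_⟩
  -- the grid cell of side `T / 2ʲ` that contains `x n`, in coordinates centred at `x 0`
  set cell : ℕ → ℕ → (Fin d → ℤ) := fun j n i => ⌊2 ^ j * ((x n i - x 0 i) / T)⌋ with hcell
  have hcoord : ∀ n i, |(x n i - x 0 i) / T| ≤ 1 := by
    intro n i
    rw [abs_div, abs_of_pos hTpos, div_le_one hTpos]
    have h1 : ‖(x n - x 0) i‖ ≤ ‖x n - x 0‖ := PiLp.norm_apply_le _ i
    have h2 := hx n 0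
    rw [dist_eq_norm] at h2
    have h3 : |x n i - x 0 i| = ‖(x n - x 0) i‖ := by simp [Real.norm_eq_abs]
    rw [h3]
    linarith [le_abs_self D]
  have hmem : ∀ j n, cell j n ∈
      Fintype.piFinset fun _ : Fin d => Finset.Icc (-(2 ^ j : ℤ)) (2 ^ j) := by
    intro j n
    rw [Fintype.mem_piFinset]
    intro i
    have h := abs_le.1 (hcoord n i)
    have hp : (0 : ℝ) < 2 ^ j := by positivity
    rw [Finset.mem_Icc]
    constructor
    · rw [Int.le_floor]; push_cast; nlinarith
    · have : ((⌊2 ^ j * ((x n i - x 0 i) / T)⌋ : ℤ) : ℝ) ≤ ((2 ^ j : ℤ) : ℝ) :=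
        (Int.floor_le _).trans (by push_cast; nlinarith)
      exact_mod_cast this
  set rep : ℕ → (Fin d → ℤ) → ℕ := fun j c => if h : ∃ m, cell j m = c then h.choose else 0
  have hrep : ∀ j n, cell j (rep j (cell j n)) = cell j n := by
    intro j n
    have h : ∃ m, cell j m = cell j n := ⟨n, rfl⟩
    simp only [rep, dif_pos h]
    exact h.choose_spec
  have hdist : ∀ j n m, cell j n = cell j m → dist (x n) (x m) ≤ √d * T * (1 / 2) ^ j := by
    intro j n m h
    rw [EuclideanSpace.dist_eq]
    have hi : ∀ i, dist (x n i) (x m i) ^ 2 ≤ (T * (1 / 2) ^ j) ^ 2 := by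
      intro i
      have h1 := Int.abs_sub_lt_one_of_floor_eq_floor (congrFun h i)
      have h2 : 2 ^ j * ((x n i - x 0 i) / T) - 2 ^ j * ((x m i - x 0 i) / T)
          = (x n i - x m i) / (T * (1 / 2) ^ j) := by
        rw [one_div_pow]
        field_simp
        ring
      rw [h2, abs_div, abs_of_pos (a := T * (1 / 2) ^ j) (by positivity),
        div_lt_one (by positivity)] at h1
      rw [Real.dist_eq]
      gcongr
    calc √(∑ i, dist (x n i) (x m i) ^ 2) ≤ √(∑ _i : Fin d, (T * (1 / 2) ^ j) ^ 2) :=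
          Real.sqrt_le_sqrt (Finset.sum_le_sum fun i _ => hi i)
      _ = √d * T * (1 / 2) ^ j := by
          rw [Finset.sum_const, Finset.card_univ, Fintype.card_fin, nsmul_eq_mul,
            Real.sqrt_mul (by positivity), Real.sqrt_sq (by positivity), mul_assoc]
  refine ⟨fun j n => if j = 0 then 0 else rep j (cell j n), fun j => if j = 0 then {0} else
    (Fintype.piFinset fun _ : Fin d => Finset.Icc (-(2 ^ j : ℤ)) (2 ^ j)).image (rep j),
    fun n => by simp, fun j n => ?_, fun j => ?_, fun j n => ?_⟩
  · rcases eq_or_ne j 0 with rfl | hj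
    · simp
    · simp only [hj, if_false]
      exact Finset.mem_image_of_mem _ (hmem j n)
  · rcases eq_or_ne j 0 with rfl | hj
    · simpa using Nat.one_le_pow _ _ (by norm_num)
    · simp only [hj, if_false]
      refine Finset.card_image_le.trans ?_
      rw [Fintype.card_piFinset, Finset.prod_const, Finset.card_univ, Fintype.card_fin,
        Int.card_Icc]
      refine Nat.pow_le_pow_left ?_ d
      have : (1 : ℤ) ≤ 2 ^ j := one_le_pow₀ (by norm_num)
      zify
      rw [Int.toNat_of_nonneg (by linarith)]
      linarith
  · rcases eq_or_ne j 0 with rfl | hj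
    · simp only [if_true, pow_zero, mul_one]
      refine (hx n 0).trans ?_
      have : 0 ≤ √(d : ℝ) * T := by positivity
      nlinarith [le_abs_self D]
    · simp only [hj, if_false]
      refine (hdist j n _ (hrep j n).symm).trans ?_
      gcongr
      linarith

/-- Chaining for a process over a finite uniform probability space `E`, indexed by a bounded
sequence of points of `ℝ^d`: if its increments satisfy the moment bound
`∑ |S n - S m| ^ (2q) ≤ K * dist (x n) (x m) ^ (2qθ)` with `q` large compared with `d / θ`, then
`|S n - S 0|` has a majorant, uniform in `n`, whose `2q`-th moment is at most a constant times
`K`. -/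
lemma exists_chaining_majorant (d : ℕ) (D θ : ℝ) (hθ : 0 < θ) (q : ℕ) (hq : q ≠ 0)
    (hqθ : 2 * d + 1 ≤ q * θ) :
    ∃ C : ℝ, 0 < C ∧ ∀ x : ℕ → Dec d, (∀ n m, dist (x n) (x m) ≤ D) →
      ∀ (E : Type) [Fintype E] (S : E → ℕ → ℝ) (K : ℝ), 0 ≤ K →
        (∀ n m, ∑ ε, (S ε n - S ε m) ^ (2 * q) ≤ K * dist (x n) (x m) ^ (2 * q * θ)) →
        ∃ Y : E → ℝ, (∀ ε n, |S ε n - S ε 0| ≤ Y ε) ∧ ∑ ε, Y ε ^ (2 * q) ≤ C * K := by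
  obtain ⟨R, hR, hnet⟩ := exists_dyadic_net d D
  -- increments at scale `2⁻ʲ` are of order `τ ^ (2 * j)`; they are compared with weights `τ ^ j`
  set τ : ℝ := (1 / 2) ^ (θ / 2) with hτ
  have hτ0 : 0 < τ := by positivity
  have hτ1 : τ < 1 := Real.rpow_lt_one (by norm_num) (by norm_num) (by positivity)
  have hτq : τ ^ (2 * q) ≤ (1 / 2) ^ (2 * d + 1) := by
    rw [hτ, ← Real.rpow_natCast, ← Real.rpow_mul (by norm_num), ← Real.rpow_natCast (1 / 2)]
    refine Real.rpow_le_rpow_of_exponent_ge (by norm_num) (by norm_num) ?_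
    push_cast
    linarith
  set C₀ : ℝ := (2 * R) ^ (2 * q * θ) * 36 ^ d with hC₀
  have hC₀pos : 0 < C₀ := by positivity
  refine ⟨2 * C₀ * (1 - τ)⁻¹ ^ (2 * q), by have := sub_pos.2 hτ1; positivity, ?_⟩
  intro x hx E _ S K hK hS
  obtain ⟨ρ, F, hρ0, hρF, hFcard, hρd⟩ := hnet x hx
  have h2q : Even (2 * q) := even_two_mul q
  have h2q0 : 2 * q ≠ 0 := by omega
  -- the pairs of consecutive approximants that are close to each other
  set Q : ℕ → Finset (ℕ × ℕ) := fun j =>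
    (F (j + 1) ×ˢ F j).filter fun p => dist (x p.1) (x p.2) ≤ 2 * R * (1 / 2) ^ j with hQ
  have hQmem : ∀ j n, (ρ (j + 1) n, ρ j n) ∈ Q j := by
    intro j n
    simp only [hQ, Finset.mem_filter, Finset.mem_product]
    refine ⟨⟨hρF _ _, hρF _ _⟩, ?_⟩
    have h1 := hρd (j + 1) n
    have h2 := hρd j n
    have h3 := dist_triangle_left (x (ρ (j + 1) n)) (x (ρ j n)) (x n)
    have h4 : R * (1 / 2) ^ (j + 1) ≤ R * (1 / 2) ^ j := by
      rw [pow_succ]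
      have : 0 < R * (1 / 2) ^ j := by positivity
      linarith
    linarith
  have hQcard : ∀ j, ((Q j).card : ℝ) ≤ 36 ^ d * (2 ^ (2 * d)) ^ j := by
    intro j
    have h1 : (Q j).card ≤ (3 * 2 ^ (j + 1)) ^ d * (3 * 2 ^ j) ^ d := by
      refine (Finset.card_filter_le _ _).trans ?_
      rw [Finset.card_product]
      exact Nat.mul_le_mul (hFcard _) (hFcard _)
    have h2 : (3 * 2 ^ (j + 1)) ^ d * (3 * 2 ^ j) ^ d ≤ 36 ^ d * (2 ^ (2 * d)) ^ j := by
      rw [← mul_pow, ← pow_mul, show 2 * d * j = (2 * j) * d by ring, pow_mul, ← mul_pow]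
      refine Nat.pow_le_pow_left ?_ d
      rw [pow_succ, two_mul, pow_add]
      nlinarith [Nat.zero_le (2 ^ j * 2 ^ j)]
    exact_mod_cast h1.trans h2
  set b : E → ℕ → ℝ := fun ε j => ∑ p ∈ Q j, ((S ε p.1 - S ε p.2) / τ ^ j) ^ (2 * q) with hb
  have hb0 : ∀ ε j, 0 ≤ b ε j := fun ε j => Finset.sum_nonneg fun p _ => h2q.pow_nonneg _
  have hbsum : ∀ j, ∑ ε, b ε j ≤ C₀ * K * (1 / 2) ^ j := by
    intro j
    simp only [hb]
    rw [Finset.sum_comm]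
    have hp : ∀ p ∈ Q j, ∑ ε, ((S ε p.1 - S ε p.2) / τ ^ j) ^ (2 * q) ≤
        K * (2 * R) ^ (2 * q * θ) * (τ ^ (2 * q)) ^ j := by
      intro p hp
      have hd : dist (x p.1) (x p.2) ≤ 2 * R * (1 / 2) ^ j := (Finset.mem_filter.1 hp).2
      simp_rw [div_pow]
      rw [← Finset.sum_div, div_le_iff₀ (by positivity)]
      refine (hS p.1 p.2).trans ?_
      have h1 : dist (x p.1) (x p.2) ^ (2 * q * θ) ≤ (2 * R * (1 / 2) ^ j) ^ (2 * q * θ) :=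
        Real.rpow_le_rpow dist_nonneg hd (by positivity)
      have h2 : (((1 : ℝ) / 2) ^ j) ^ (2 * q * θ) = (τ ^ (2 * q)) ^ j * (τ ^ j) ^ (2 * q) := by
        rw [← pow_mul, ← pow_mul, ← pow_add, hτ, ← Real.rpow_natCast, ← Real.rpow_mul (by norm_num),
          ← Real.rpow_natCast, ← Real.rpow_mul (by norm_num)]
        congr 1
        push_cast
        ring
      rw [Real.mul_rpow (by positivity) (by positivity), h2] at h1
      calc K * dist (x p.1) (x p.2) ^ (2 * q * θ)
          ≤ K * ((2 * R) ^ (2 * q * θ) * ((τ ^ (2 * q)) ^ j * (τ ^ j) ^ (2 * q))) := by gcongr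
        _ = _ := by ring
    calc ∑ p ∈ Q j, ∑ ε, ((S ε p.1 - S ε p.2) / τ ^ j) ^ (2 * q)
        ≤ (Q j).card * (K * (2 * R) ^ (2 * q * θ) * (τ ^ (2 * q)) ^ j) := by
          rw [← nsmul_eq_mul]; exact Finset.sum_le_card_nsmul _ _ _ hp
      _ ≤ (36 ^ d * (2 ^ (2 * d)) ^ j) *
            (K * (2 * R) ^ (2 * q * θ) * ((1 / 2) ^ (2 * d + 1)) ^ j) := by
          gcongr
          exact hQcard j
      _ = C₀ * K * (2 ^ (2 * d) * (1 / 2) ^ (2 * d + 1)) ^ j := by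
          rw [hC₀, mul_pow]; ring
      _ = _ := by
          congr 2
          rw [pow_succ, ← mul_assoc, ← mul_pow]
          norm_num
  have hgeo : Summable fun j : ℕ => C₀ * K * (1 / 2 : ℝ) ^ j :=
    summable_geometric_two.mul_left _
  have hbs : ∀ ε, Summable (b ε) := fun ε =>
    Summable.of_nonneg_of_le (hb0 ε) (fun j => (Finset.single_le_sum (fun ε _ => hb0 ε j)
      (Finset.mem_univ ε)).trans (hbsum j)) hgeo
  set M : E → ℝ := fun ε => (∑' j, b ε j) ^ ((1 : ℝ) / (2 * q : ℕ)) with hM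
  have hM0 : ∀ ε, 0 ≤ M ε := fun ε => Real.rpow_nonneg (tsum_nonneg (hb0 ε)) _
  have hMpow : ∀ ε, M ε ^ (2 * q) = ∑' j, b ε j := by
    intro ε
    simp only [hM, one_div]
    exact Real.rpow_inv_natCast_pow (tsum_nonneg (hb0 ε)) h2q0
  have hlink : ∀ ε j n, |S ε (ρ (j + 1) n) - S ε (ρ j n)| ≤ M ε * τ ^ j := by
    intro ε j n
    rw [← div_le_iff₀ (by positivity)]
    refine le_of_pow_le_pow_left₀ h2q0 (hM0 ε) ?_
    rw [hMpow]
    refine le_trans ?_ ((hbs ε).le_tsum j fun i _ => hb0 ε i)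
    refine le_trans (le_of_eq ?_) (Finset.single_le_sum
      (f := fun p : ℕ × ℕ => ((S ε p.1 - S ε p.2) / τ ^ j) ^ (2 * q))
      (fun p _ => h2q.pow_nonneg _) (hQmem j n))
    rw [div_pow, div_pow, h2q.pow_abs]
  have hchain : ∀ ε J n, |S ε (ρ J n) - S ε 0| ≤ M ε * (1 - τ)⁻¹ := by
    intro ε J n
    have h1 : |S ε (ρ J n) - S ε 0| ≤ ∑ j ∈ Finset.range J, M ε * τ ^ j := by
      have h2 := Finset.sum_range_sub (fun j => S ε (ρ j n)) J
      rw [hρ0] at h2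
      rw [← h2]
      exact (Finset.abs_sum_le_sum_abs _ _).trans (Finset.sum_le_sum fun j _ => hlink ε j n)
    refine h1.trans ?_
    rw [← Finset.mul_sum, ← tsum_geometric_of_lt_one hτ0.le hτ1]
    refine mul_le_mul_of_nonneg_left ?_ (hM0 ε)
    exact (summable_geometric_of_lt_one hτ0.le hτ1).sum_le_tsum _ fun j _ => by positivity
  have hlim : ∀ ε n, Filter.Tendsto (fun J => S ε (ρ J n)) Filter.atTop (nhds (S ε n)) := by
    intro ε n
    have hdist : Filter.Tendsto (fun J => dist (x (ρ J n)) (x n)) Filter.atTop (nhds 0) := by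
      refine squeeze_zero (fun _ => dist_nonneg) (fun J => (dist_comm _ _).trans_le (hρd J n)) ?_
      have := (tendsto_pow_atTop_nhds_zero_of_lt_one (r := (1 / 2 : ℝ)) (by norm_num)
        (by norm_num)).const_mul R
      simpa using this
    have hpow : Filter.Tendsto (fun J => (S ε (ρ J n) - S ε n) ^ (2 * q)) Filter.atTop
        (nhds 0) := by
      refine squeeze_zero (fun _ => h2q.pow_nonneg _) (fun J => (Finset.single_le_sum
        (f := fun ε => (S ε (ρ J n) - S ε n) ^ (2 * q)) (fun ε _ => h2q.pow_nonneg _)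
        (Finset.mem_univ ε)).trans (hS _ _)) ?_
      have := (hdist.rpow_const (p := 2 * q * θ) (Or.inr (by positivity))).const_mul K
      rwa [Real.zero_rpow (by positivity), mul_zero] at this
    rw [tendsto_iff_dist_tendsto_zero]
    have := hpow.rpow_const (p := (1 : ℝ) / (2 * q : ℕ)) (Or.inr (by positivity))
    rw [Real.zero_rpow (by positivity)] at this
    refine this.congr fun J => ?_
    rw [← h2q.pow_abs, one_div, Real.pow_rpow_inv_natCast (abs_nonneg _) h2q0, Real.dist_eq]
  refine ⟨fun ε => M ε * (1 - τ)⁻¹, fun ε n => ?_, ?_⟩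
  · exact le_of_tendsto ((hlim ε n).sub_const _).abs (Filter.Eventually.of_forall fun J =>
      hchain ε J n)
  · simp_rw [mul_pow, hMpow]
    rw [← Finset.sum_mul]
    have h1 : ∑ ε, ∑' j, b ε j ≤ 2 * C₀ * K := by
      rw [← Summable.tsum_finsetSum fun ε _ => hbs ε]
      have hs : Summable fun j => ∑ ε, b ε j := summable_sum fun ε _ => hbs ε
      refine (hs.tsum_le_tsum hbsum hgeo).trans (le_of_eq ?_)
      rw [tsum_mul_left, tsum_geometric_two]
      ring
    calc (∑ ε, ∑' j, b ε j) * (1 - τ)⁻¹ ^ (2 * q) ≤ 2 * C₀ * K * (1 - τ)⁻¹ ^ (2 * q) := by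
          have := sub_pos.2 hτ1
          gcongr
      _ = _ := by ring

/-- Maximal inequality for Rademacher sums of Hölder functions on a bounded subset of `ℝ^d`. The
second moment of the supremum is controlled by the squares of the Hölder constants and of the values
at one point; no further moment of the coefficients enters, because Khintchine's inequality bounds
all moments of the signed sums by these squares. -/
lemma exists_signedSum_majorant (d : ℕ) (D θ : ℝ) (hθ : 0 < θ) :
    ∃ C : ℝ, 0 < C ∧ ∀ x : ℕ → Dec d, (∀ n m, dist (x n) (x m) ≤ D) →
      ∀ (N : ℕ) (u : ℕ → Fin N → ℝ) (A B : Fin N → ℝ),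
        (∀ k n m, |u n k - u m k| ≤ A k * dist (x n) (x m) ^ θ) → (∀ k, |u 0 k| ≤ B k) →
        ∃ Y : (Fin N → Bool) → ℝ, (∀ ε n, |signedSum ε (u n)| ≤ Y ε) ∧
          ∑ ε, Y ε ^ 2 ≤ 2 ^ N * (C * (∑ k, A k ^ 2 + ∑ k, B k ^ 2)) := by
  obtain ⟨q₀, hq₀⟩ := exists_nat_ge ((2 * d + 1) / θ)
  set q := q₀ + 1 with hq
  have hqθ : 2 * d + 1 ≤ q * θ := by
    rw [div_le_iff₀ hθ] at hq₀
    rw [hq]; push_cast; nlinarith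
  obtain ⟨C, hC, hchain⟩ := exists_chaining_majorant d D θ hθ q (by omega) hqθ
  set c : ℕ → ℝ := fun q => 2 * (2 * q).factorial * Real.exp (1 / 2) with hc
  have hc0 : ∀ q, 0 < c q := fun q => by simp only [hc]; positivity
  refine ⟨2 * (1 + C * c q) + 2 * c 1, by have := hc0 q; have := hc0 1; positivity, ?_⟩
  intro x hx N u A B hA hB
  set V := ∑ k, A k ^ 2 with hV
  have hV0 : 0 ≤ V := Finset.sum_nonneg fun k _ => sq_nonneg _
  have hW0 : 0 ≤ ∑ k, B k ^ 2 := Finset.sum_nonneg fun k _ => sq_nonneg _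
  have hB' : ∑ ε : Fin N → Bool, signedSum ε (u 0) ^ 2 ≤ 2 ^ N * c 1 * ∑ k, B k ^ 2 := by
    have := sum_signedSum_pow_le 1 one_ne_zero (u 0) (√(∑ k, B k ^ 2)) (Real.sqrt_nonneg _) (by
      rw [Real.sq_sqrt hW0]
      exact Finset.sum_le_sum fun k _ => sq_le_sq.2 ((hB k).trans (le_abs_self _)))
    rwa [mul_one, Real.sq_sqrt hW0, Fintype.card_fin] at this
  obtain ⟨Y, hY, hYsum⟩ := hchain x hx (Fin N → Bool) (fun ε n => signedSum ε (u n))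
    (2 ^ N * c q * V ^ q) (by have := hc0 q; positivity) (by
      intro n m
      simp_rw [← signedSum_sub]
      have h1 := sum_signedSum_pow_le q (by omega) (fun k => u n k - u m k)
        (√V * dist (x n) (x m) ^ θ) (by positivity) (by
          rw [mul_pow, Real.sq_sqrt hV0, hV, Finset.sum_mul]
          refine Finset.sum_le_sum fun k _ => ?_
          rw [← mul_pow]
          exact sq_le_sq.2 ((hA k n m).trans (le_abs_self _)))
      refine h1.trans (le_of_eq ?_)
      rw [Fintype.card_fin, mul_pow, pow_mul, Real.sq_sqrt hV0, ← Real.rpow_natCast (_ ^ θ),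
        ← Real.rpow_mul dist_nonneg, mul_assoc]
      rw [mul_comm θ]
      push_cast
      simp only [hc]
      ring)
  have hY0 : ∀ ε, 0 ≤ Y ε := fun ε => (abs_nonneg _).trans (hY ε 0)
  have hY2 : ∑ ε, Y ε ^ 2 ≤ 2 ^ N * (1 + C * c q) * V := by
    rcases hV0.eq_or_lt with h0 | hVpos
    · rw [← h0, zero_pow (by omega : q ≠ 0), mul_zero, mul_zero] at hYsum
      have : ∀ ε, Y ε = 0 := by
        intro ε
        have h1 := (Finset.single_le_sum (f := fun ε => Y ε ^ (2 * q))
          (fun ε _ => pow_nonneg (hY0 ε) _) (Finset.mem_univ ε)).trans hYsum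
        exact pow_eq_zero_iff (by omega : 2 * q ≠ 0) |>.1
          (le_antisymm h1 (pow_nonneg (hY0 ε) _))
      simp [this, ← h0]
    · -- `t ≤ 1 + t ^ q` with `t = Y² / V` replaces the comparison of `L²` and `L^{2q}` norms
      have h1 : ∀ ε, Y ε ^ 2 ≤ V * (1 + Y ε ^ (2 * q) / V ^ q) := by
        intro ε
        have ht : Y ε ^ 2 / V ≤ 1 + (Y ε ^ 2 / V) ^ q := by
          have h0 : 0 ≤ Y ε ^ 2 / V := by positivity
          rcases le_total (Y ε ^ 2 / V) 1 with h | h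
          · have := pow_nonneg h0 q
            linarith
          · have := le_self_pow₀ h (by omega : q ≠ 0)
            linarith
        rw [div_pow, ← pow_mul, div_le_iff₀ hVpos] at ht
        linarith
      calc ∑ ε, Y ε ^ 2 ≤ ∑ ε, V * (1 + Y ε ^ (2 * q) / V ^ q) :=
            Finset.sum_le_sum fun ε _ => h1 ε
        _ = V * (2 ^ N + (∑ ε, Y ε ^ (2 * q)) / V ^ q) := by
            rw [← Finset.mul_sum, Finset.sum_add_distrib, Finset.sum_div]
            simp
        _ ≤ V * (2 ^ N + (C * (2 ^ N * c q * V ^ q)) / V ^ q) := by gcongr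
        _ = _ := by field_simp
  refine ⟨fun ε => |signedSum ε (u 0)| + Y ε, fun ε n => ?_, ?_⟩
  · have h1 := hY ε n
    have h2 := abs_add_le (signedSum ε (u 0)) (signedSum ε (u n) - signedSum ε (u 0))
    rw [add_sub_cancel] at h2
    linarith
  · calc ∑ ε, (|signedSum ε (u 0)| + Y ε) ^ 2
        ≤ ∑ ε, (2 * signedSum ε (u 0) ^ 2 + 2 * Y ε ^ 2) := by
          refine Finset.sum_le_sum fun ε _ => ?_
          rw [← sq_abs (signedSum ε (u 0))]
          nlinarith [sq_nonneg (|signedSum ε (u 0)| - Y ε)]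
      _ ≤ 2 * (2 ^ N * c 1 * ∑ k, B k ^ 2) + 2 * (2 ^ N * (1 + C * c q) * V) := by
          rw [Finset.sum_add_distrib, ← Finset.mul_sum, ← Finset.mul_sum]
          gcongr
      _ ≤ _ := by
          have h1 : 0 ≤ 2 ^ N * (2 * (1 + C * c q) * ∑ k, B k ^ 2) := by
            have := hc0 q; positivity
          have h2 : 0 ≤ 2 ^ N * (2 * c 1 * V) := by
            have := hc0 1; positivity
          linarith

/-! ### Symmetrization -/

section Symmetrization

variable {E : Type*} [MeasurableSpace E]

lemma measurable_signedSum_comp {ι : Type*} [Fintype ι] (ε : ι → Bool) {u : ι → E → ℝ}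
    (hu : ∀ k, Measurable (u k)) :
    Measurable fun p => signedSum ε fun k => u k p := by
  unfold signedSum
  exact Finset.measurable_sum _ fun k _ => (hu k).const_mul _

/-- Symmetrization, first half: centring by the mean is replaced by centring with an independent
copy of the sample. -/
lemma lintegral_iSup_centered_le (ν : Measure E) [IsProbabilityMeasure ν] (N : ℕ)
    (g : ℕ → E → ℝ) (hg : ∀ n, Measurable (g n)) (hgi : ∀ n, Integrable (g n) ν) :
    ∫⁻ w, ⨆ n, ‖∑ k, (g n (w k) - ∫ e, g n e ∂ν)‖ₑ ^ 2 ∂(Measure.pi fun _ : Fin N => ν) ≤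
      ∫⁻ p, ⨆ n, ‖∑ k, (g n (p k).1 - g n (p k).2)‖ₑ ^ 2
        ∂(Measure.pi fun _ : Fin N => ν.prod ν) := by
  set π := Measure.pi fun _ : Fin N => ν with hπ
  have hmp := measurePreserving_arrowProdEquivProdArrow E E (Fin N) (fun _ => ν) (fun _ => ν)
  have hG : Measurable fun z : (Fin N → E) × (Fin N → E) =>
      ⨆ n, ‖∑ k, (g n (z.1 k) - g n (z.2 k))‖ₑ ^ 2 := by
    refine Measurable.iSup fun n => ?_
    have := hg n
    fun_prop
  have h1 : ∫⁻ p, ⨆ n, ‖∑ k, (g n (p k).1 - g n (p k).2)‖ₑ ^ 2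
        ∂(Measure.pi fun _ : Fin N => ν.prod ν) =
      ∫⁻ w, ∫⁻ w', ⨆ n, ‖∑ k, (g n (w k) - g n (w' k))‖ₑ ^ 2 ∂π ∂π := by
    rw [← lintegral_prod _ hG.aemeasurable, ← hmp.lintegral_comp hG]
    rfl
  rw [h1]
  refine lintegral_mono fun w => iSup_le fun n => ?_
  have hcomp : ∀ k, Integrable (fun w' : Fin N → E => g n (w' k)) π := fun k =>
    (measurePreserving_eval (fun _ : Fin N => ν) k).integrable_comp_of_integrable (hgi n)
  have h2 : ∑ k, (g n (w k) - ∫ e, g n e ∂ν) =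
      ∫ w', ∑ k, (g n (w k) - g n (w' k)) ∂π := by
    have hi : ∀ k ∈ Finset.univ, Integrable (fun w' : Fin N → E => g n (w k) - g n (w' k)) π :=
      fun k _ => (integrable_const _).sub (hcomp k)
    rw [integral_finsetSum _ hi]
    refine Finset.sum_congr rfl fun k _ => ?_
    rw [integral_sub (integrable_const _) (hcomp k), integral_const]
    simp only [probReal_univ, one_smul]
    rw [hπ, integral_comp_eval (μ := fun _ : Fin N => ν) (i := k) (hg n).aestronglyMeasurable]
  have hm : Measurable fun w' : Fin N → E => ∑ k, (g n (w k) - g n (w' k)) := by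
    have := hg n
    fun_prop
  have h3 : ‖∫ w', ∑ k, (g n (w k) - g n (w' k)) ∂π‖ₑ ≤
      eLpNorm (fun w' => ∑ k, (g n (w k) - g n (w' k))) 2 π := by
    refine (enorm_integral_le_lintegral_enorm _).trans ?_
    rw [← eLpNorm_one_eq_lintegral_enorm]
    exact eLpNorm_le_eLpNorm_of_exponent_le (by norm_num) hm.aestronglyMeasurable
  rw [h2]
  calc ‖∫ w', ∑ k, (g n (w k) - g n (w' k)) ∂π‖ₑ ^ 2
      ≤ eLpNorm (fun w' => ∑ k, (g n (w k) - g n (w' k))) 2 π ^ 2 := by gcongr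
    _ = ∫⁻ w', ‖∑ k, (g n (w k) - g n (w' k))‖ₑ ^ 2 ∂π := by
        simpa using eLpNorm_nnreal_pow_eq_lintegral (f := fun w' : Fin N → E =>
          ∑ k, (g n (w k) - g n (w' k))) (μ := π) (p := 2) two_ne_zero
    _ ≤ _ := lintegral_mono fun w' =>
        le_iSup (fun n => ‖∑ k, (g n (w k) - g n (w' k))‖ₑ ^ 2) n

/-- Symmetrization, second half: exchanging the two members of the pairs with `ε k = false`
preserves the law of the sample of pairs, and multiplies the corresponding differences by `-1`. -/
lemma lintegral_iSup_signedSum_eq (ν : Measure E) [IsProbabilityMeasure ν] (N : ℕ)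
    (g : ℕ → E → ℝ) (hg : ∀ n, Measurable (g n)) (ε : Fin N → Bool) :
    ∫⁻ p, ⨆ n, ‖∑ k, (g n (p k).1 - g n (p k).2)‖ₑ ^ 2
        ∂(Measure.pi fun _ : Fin N => ν.prod ν) =
      ∫⁻ p, ⨆ n, ‖signedSum ε fun k => g n (p k).1 - g n (p k).2‖ₑ ^ 2
        ∂(Measure.pi fun _ : Fin N => ν.prod ν) := by
  have hmp := measurePreserving_pi (fun _ : Fin N => ν.prod ν) (fun _ : Fin N => ν.prod ν)
    (f := fun k => if ε k then id else Prod.swap) (fun k => by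
      by_cases h : ε k
      · simpa [h] using MeasurePreserving.id _
      · simpa [h] using Measure.measurePreserving_swap)
  have hG : Measurable fun p : Fin N → E × E =>
      ⨆ n, ‖∑ k, (g n (p k).1 - g n (p k).2)‖ₑ ^ 2 := by
    refine Measurable.iSup fun n => ?_
    have := hg n
    fun_prop
  rw [← hmp.lintegral_comp hG]
  refine lintegral_congr fun p => iSup_congr fun n => ?_
  congr 2
  refine Finset.sum_congr rfl fun k _ => ?_
  by_cases h : ε k <;> simp [h, boolSign]

end Symmetrization

/-! ### The uniform error of a sample average -/

/-- `min(a, b) ≤ a ^ θ * b ^ κ` for `θ + κ = 1`. -/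
lemma le_rpow_mul_rpow_of_le {t a b θ κ : ℝ} (ht : 0 ≤ t) (hθ : 0 < θ) (hκ : 0 < κ)
    (hsum : θ + κ = 1) (ha : t ≤ a) (hb : t ≤ b) : t ≤ a ^ θ * b ^ κ := by
  calc t = t ^ θ * t ^ κ := by
        rw [← Real.rpow_add_of_nonneg ht hθ.le hκ.le, hsum, Real.rpow_one]
    _ ≤ a ^ θ * b ^ κ := by
        have := ht.trans ha
        gcongr

lemma rpow_le_rpow_mul_one_add_div {t v κ : ℝ} (ht : 0 ≤ t) (hv : 0 < v) (hκ : 0 < κ)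
    (hκ1 : κ ≤ 1) : t ^ κ ≤ v ^ κ * (1 + t / v) := by
  have h0 : 0 ≤ t / v := by positivity
  have h1 : (t / v) ^ κ ≤ 1 + t / v := by
    rcases le_total (t / v) 1 with h | h
    · have := Real.rpow_le_one h0 h hκ.le
      linarith
    · have := Real.rpow_le_rpow_of_exponent_le h hκ1
      rw [Real.rpow_one] at this
      linarith
  rw [Real.div_rpow ht hv.le, div_le_iff₀ (by positivity)] at h1
  linarith

/-- Uniform second-moment bound for centred sums over a family of functions that is uniformly
Lipschitz in a parameter ranging over a bounded subset of `ℝ^d`. The Lipschitz bound and the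
envelope are interpolated into a Hölder bound of exponent `θ` whose constant has second moment of
order `v ^ κ`, where `v` bounds the second moment of the envelope. -/
lemma exists_lintegral_iSup_centered_le (d : ℕ) (D Λ θ κ : ℝ) (hΛ : 0 ≤ Λ) (hθ : 0 < θ)
    (hκ : 0 < κ) (hsum : θ + κ = 1) :
    ∃ C : ℝ, 0 < C ∧ ∀ x : ℕ → Dec d, (∀ n m, dist (x n) (x m) ≤ D) →
      ∀ (E : Type*) [MeasurableSpace E] (ν : Measure E) [IsProbabilityMeasure ν] (N : ℕ)
        (g : ℕ → E → ℝ) (v : ℝ), (∀ n, Measurable (g n)) → (∀ n, Integrable (g n) ν) →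
        (∀ e n m, |g n e - g m e| ≤ Λ * dist (x n) (x m)) → 0 < v →
        ∫⁻ e, ⨆ n, ‖g n e‖ₑ ^ 2 ∂ν ≤ ENNReal.ofReal v →
        ∫⁻ w, ⨆ n, ‖∑ k, (g n (w k) - ∫ e, g n e ∂ν)‖ₑ ^ 2 ∂(Measure.pi fun _ : Fin N => ν) ≤
          ENNReal.ofReal (N * (C * (v ^ κ + v))) := by
  obtain ⟨C, hC, hmaj⟩ := exists_signedSum_majorant d D θ hθ
  set a₀ : ℝ := (2 * Λ) ^ (2 * θ) with ha₀
  have ha₀0 : 0 ≤ a₀ := by positivity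
  refine ⟨C * (17 * a₀ + 4), by positivity, ?_⟩
  intro x hx E _ ν _ N g v hg hgi hLip hv hvar
  have hx0 : ∀ n, dist (x n) (x 0) ≤ |D| := fun n => (hx n 0).trans (le_abs_self D)
  -- `s` is a finite measurable envelope of the family, with second moment at most `v`
  set s₂ : E → ℝ≥0∞ := fun e => ⨆ n, ‖g n e‖ₑ ^ 2 with hs₂
  have hs₂m : Measurable s₂ := Measurable.iSup fun n => by have := hg n; fun_prop
  have hs₂fin : ∀ e, s₂ e ≠ ∞ := by
    intro e
    have : s₂ e ≤ ENNReal.ofReal (|g 0 e| + Λ * |D|) ^ 2 := by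
      refine iSup_le fun n => ?_
      gcongr
      rw [Real.enorm_eq_ofReal_abs]
      refine ENNReal.ofReal_le_ofReal ?_
      have h1 := hLip e n 0
      have h2 := mul_le_mul_of_nonneg_left (hx0 n) hΛ
      have h3 := abs_add_le (g 0 e) (g n e - g 0 e)
      rw [add_sub_cancel] at h3
      linarith
    exact ne_top_of_le_ne_top (by simp) this
  set s : E → ℝ := fun e => √(s₂ e).toReal with hs
  have hsm : Measurable s := hs₂m.ennreal_toReal.sqrt
  have hs0 : ∀ e, 0 ≤ s e := fun e => Real.sqrt_nonneg _
  have hssq : ∀ e, ENNReal.ofReal (s e ^ 2) = s₂ e := by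
    intro e
    rw [hs, Real.sq_sqrt ENNReal.toReal_nonneg, ENNReal.ofReal_toReal (hs₂fin e)]
  have hgs : ∀ n e, |g n e| ≤ s e := by
    intro n e
    refine Real.le_sqrt_of_sq_le ?_
    rw [sq_abs, ← ENNReal.ofReal_le_iff_le_toReal (hs₂fin e)]
    refine le_trans (le_of_eq ?_) (le_iSup (fun n => ‖g n e‖ₑ ^ 2) n)
    rw [Real.enorm_eq_ofReal_abs, ← ENNReal.ofReal_pow (abs_nonneg _), sq_abs]
  set α : ℝ := a₀ * v ^ κ with hα
  have hα0 : 0 ≤ α := by positivity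
  set γ : ℝ := 8 * α / v + 2 with hγ
  have hγ0 : 0 ≤ γ := by positivity
  set φ : E × E → ℝ := fun z => C * (α + γ * (s z.1 ^ 2 + s z.2 ^ 2)) with hφ
  have hφ0 : ∀ z, 0 ≤ φ z := fun z => by simp only [hφ]; positivity
  have hφm : Measurable φ := by fun_prop
  -- the bound for the Rademacher sums with the sample held fixed
  have hpoint : ∀ p : Fin N → E × E, ∑ ε : Fin N → Bool,
      ⨆ n, ‖signedSum ε fun k => g n (p k).1 - g n (p k).2‖ₑ ^ 2 ≤
        ENNReal.ofReal (2 ^ N * ∑ k, φ (p k)) := by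
    intro p
    set T : Fin N → ℝ := fun k => s (p k).1 + s (p k).2 with hT
    have hT0 : ∀ k, 0 ≤ T k := fun k => add_nonneg (hs0 _) (hs0 _)
    obtain ⟨Y, hY, hYsum⟩ := hmaj x hx N (fun n k => g n (p k).1 - g n (p k).2)
      (fun k => (2 * Λ) ^ θ * (2 * T k) ^ κ) T (by
        intro k n m
        have h1 := hLip (p k).1 n m
        have h2 := hLip (p k).2 n m
        have h3 := abs_sub (g n (p k).1 - g m (p k).1) (g n (p k).2 - g m (p k).2)
        have h4 : g n (p k).1 - g n (p k).2 - (g m (p k).1 - g m (p k).2) =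
          g n (p k).1 - g m (p k).1 - (g n (p k).2 - g m (p k).2) := by ring
        have h5 := abs_sub (g n (p k).1) (g m (p k).1)
        have h6 := abs_sub (g n (p k).2) (g m (p k).2)
        have h7 := hgs n (p k).1
        have h8 := hgs m (p k).1
        have h9 := hgs n (p k).2
        have h10 := hgs m (p k).2
        rw [h4]
        have := le_rpow_mul_rpow_of_le (abs_nonneg _) hθ hκ hsum
          (a := 2 * Λ * dist (x n) (x m)) (b := 2 * T k) (h3.trans (by linarith))
          (h3.trans (by simp only [hT]; linarith))
        rw [Real.mul_rpow (by positivity) dist_nonneg] at this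
        linarith) (by
        intro k
        exact (abs_sub _ _).trans (add_le_add (hgs _ _) (hgs _ _)))
    have hA : ∀ k, ((2 * Λ) ^ θ * (2 * T k) ^ κ) ^ 2 ≤ α * (1 + 4 * T k ^ 2 / v) := by
      intro k
      have hTk := hT0 k
      have h1 := rpow_le_rpow_mul_one_add_div (t := (2 * T k) ^ 2) (by positivity) hv hκ
        (by linarith)
      have h2 : ((2 * T k) ^ κ) ^ 2 = ((2 * T k) ^ 2) ^ κ := by
        rw [← Real.rpow_natCast, ← Real.rpow_mul (by positivity), ← Real.rpow_natCast (2 * T k),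
          ← Real.rpow_mul (by positivity), mul_comm κ]
      have h3 : ((2 * Λ) ^ θ) ^ 2 = a₀ := by
        rw [ha₀, ← Real.rpow_natCast, ← Real.rpow_mul (by positivity), mul_comm θ]
        norm_num
      rw [mul_pow, h2, h3]
      calc a₀ * ((2 * T k) ^ 2) ^ κ ≤ a₀ * (v ^ κ * (1 + (2 * T k) ^ 2 / v)) := by gcongr
        _ = _ := by rw [hα]; ring
    have hsumφ : C * (∑ k, ((2 * Λ) ^ θ * (2 * T k) ^ κ) ^ 2 + ∑ k, T k ^ 2) ≤ ∑ k, φ (p k) := by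
      rw [← Finset.sum_add_distrib, Finset.mul_sum]
      refine Finset.sum_le_sum fun k _ => ?_
      refine mul_le_mul_of_nonneg_left ?_ hC.le
      have h1 : T k ^ 2 ≤ 2 * (s (p k).1 ^ 2 + s (p k).2 ^ 2) := by
        simp only [hT]
        nlinarith [sq_nonneg (s (p k).1 - s (p k).2)]
      calc ((2 * Λ) ^ θ * (2 * T k) ^ κ) ^ 2 + T k ^ 2
          ≤ α * (1 + 4 * T k ^ 2 / v) + T k ^ 2 := by gcongr; exact hA k
        _ = α + (4 * α / v + 1) * T k ^ 2 := by ring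
        _ ≤ α + (4 * α / v + 1) * (2 * (s (p k).1 ^ 2 + s (p k).2 ^ 2)) := by gcongr
        _ = _ := by rw [hγ]; ring
    calc ∑ ε : Fin N → Bool, ⨆ n, ‖signedSum ε fun k => g n (p k).1 - g n (p k).2‖ₑ ^ 2
        ≤ ∑ ε : Fin N → Bool, ENNReal.ofReal (Y ε ^ 2) := by
          refine Finset.sum_le_sum fun ε _ => iSup_le fun n => ?_
          rw [Real.enorm_eq_ofReal_abs, ← ENNReal.ofReal_pow (abs_nonneg _)]
          refine ENNReal.ofReal_le_ofReal ?_
          have := hY ε n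
          gcongr
      _ = ENNReal.ofReal (∑ ε, Y ε ^ 2) :=
          (ENNReal.ofReal_sum_of_nonneg fun ε _ => sq_nonneg _).symm
      _ ≤ _ := ENNReal.ofReal_le_ofReal (hYsum.trans (by gcongr))
  have hφint : ∫⁻ z, ENNReal.ofReal (φ z) ∂(ν.prod ν) ≤
      ENNReal.ofReal (C * (17 * a₀ + 4) * (v ^ κ + v)) := by
    have h1 : ∀ z, ENNReal.ofReal (φ z) =
        ENNReal.ofReal (C * α) + ENNReal.ofReal (C * γ) * (s₂ z.1 + s₂ z.2) := by
      intro z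
      rw [← hssq, ← hssq, ← ENNReal.ofReal_add (sq_nonneg _) (sq_nonneg _),
        ← ENNReal.ofReal_mul (by positivity), ← ENNReal.ofReal_add (by positivity) (by positivity)]
      congr 1
      simp only [hφ]
      ring
    have hfst : ∫⁻ z : E × E, s₂ z.1 ∂(ν.prod ν) ≤ ENNReal.ofReal v := by
      rw [measurePreserving_fst.lintegral_comp hs₂m]
      exact hvar
    have hsnd : ∫⁻ z : E × E, s₂ z.2 ∂(ν.prod ν) ≤ ENNReal.ofReal v := by
      rw [measurePreserving_snd.lintegral_comp hs₂m]
      exact hvar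
    simp_rw [h1]
    rw [lintegral_add_left measurable_const, lintegral_const, measure_univ, mul_one,
      lintegral_const_mul _ (by fun_prop), lintegral_add_left (by fun_prop)]
    calc _ ≤ ENNReal.ofReal (C * α) +
          ENNReal.ofReal (C * γ) * (ENNReal.ofReal v + ENNReal.ofReal v) := by gcongr
      _ = ENNReal.ofReal (C * α + C * γ * (v + v)) := by
          rw [← ENNReal.ofReal_add hv.le hv.le, ← ENNReal.ofReal_mul (by positivity),
            ← ENNReal.ofReal_add (by positivity) (by positivity)]
      _ ≤ _ := by
          refine ENNReal.ofReal_le_ofReal ?_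
          have h2 : C * α + C * γ * (v + v) = C * (17 * a₀ * v ^ κ + 4 * v) := by
            rw [hγ, hα]; field_simp; ring
          rw [h2, mul_assoc C]
          refine mul_le_mul_of_nonneg_left ?_ hC.le
          have h3 : 0 ≤ v ^ κ := by positivity
          nlinarith [mul_nonneg ha₀0 hv.le]
  refine (lintegral_iSup_centered_le ν N g hg hgi).trans ?_
  have hpow0 : (2 ^ N : ℝ≥0∞) ≠ 0 := by positivity
  have hpowt : (2 ^ N : ℝ≥0∞) ≠ ∞ := by finiteness
  rw [← ENNReal.mul_le_mul_iff_right hpow0 hpowt]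
  calc 2 ^ N * ∫⁻ p, ⨆ n, ‖∑ k, (g n (p k).1 - g n (p k).2)‖ₑ ^ 2
        ∂(Measure.pi fun _ : Fin N => ν.prod ν)
      = ∑ ε : Fin N → Bool, ∫⁻ p, ⨆ n, ‖signedSum ε fun k => g n (p k).1 - g n (p k).2‖ₑ ^ 2
        ∂(Measure.pi fun _ : Fin N => ν.prod ν) := by
        simp_rw [← lintegral_iSup_signedSum_eq ν N g hg]
        simp
    _ = ∫⁻ p, ∑ ε : Fin N → Bool, ⨆ n, ‖signedSum ε fun k => g n (p k).1 - g n (p k).2‖ₑ ^ 2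
        ∂(Measure.pi fun _ : Fin N => ν.prod ν) := by
        refine (lintegral_finsetSum _ fun ε _ => Measurable.iSup fun n => ?_).symm
        have hm := measurable_signedSum_comp ε
          (u := fun k (p : Fin N → E × E) => g n (p k).1 - g n (p k).2)
          (fun k => by have := hg n; fun_prop)
        fun_prop
    _ ≤ ∫⁻ p, 2 ^ N * ∑ k, ENNReal.ofReal (φ (p k)) ∂(Measure.pi fun _ : Fin N => ν.prod ν) := by
        refine lintegral_mono fun p => (hpoint p).trans (le_of_eq ?_)
        rw [ENNReal.ofReal_mul (by positivity), ENNReal.ofReal_sum_of_nonneg fun k _ => hφ0 _]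
        congr 1
        rw [ENNReal.ofReal_pow (by norm_num)]
        norm_num
    _ = 2 ^ N * ∑ k : Fin N, ∫⁻ z, ENNReal.ofReal (φ z) ∂(ν.prod ν) := by
        rw [lintegral_const_mul _ (by fun_prop), lintegral_finsetSum _ (fun k _ => by fun_prop)]
        congr 1
        refine Finset.sum_congr rfl fun k _ => ?_
        exact (measurePreserving_eval (fun _ : Fin N => ν.prod ν) k).lintegral_comp
          (f := fun z => ENNReal.ofReal (φ z)) (by fun_prop)
    _ ≤ 2 ^ N * ENNReal.ofReal (N * (C * (17 * a₀ + 4) * (v ^ κ + v))) := by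
        gcongr
        rw [Finset.sum_const, Finset.card_univ, Fintype.card_fin, nsmul_eq_mul,
          ENNReal.ofReal_mul (by positivity), ENNReal.ofReal_natCast]
        gcongr

/-- The root-mean-square of the uniform error of a sample average of `N` i.i.d. terms is of order
`√((v ^ κ + v) / N)`. -/
lemma exists_eLpNorm_iSup_average_sub_le (d : ℕ) (D Λ θ κ : ℝ) (hΛ : 0 ≤ Λ) (hθ : 0 < θ)
    (hκ : 0 < κ) (hsum : θ + κ = 1) :
    ∃ C : ℝ, 0 < C ∧ ∀ x : ℕ → Dec d, (∀ n m, dist (x n) (x m) ≤ D) →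
      ∀ (E : Type*) [MeasurableSpace E] (Ω : Type*) [MeasurableSpace Ω] (P : Measure Ω)
        [IsProbabilityMeasure P] (N : ℕ) (W : ℕ → Ω → E) (W₀ : Ω → E) (g : ℕ → E → ℝ) (v : ℝ),
        1 ≤ N → iIndepFun (fun k : Fin N => W k) P → (∀ k < N, IdentDistrib (W k) W₀ P P) →
        (∀ n, Measurable (g n)) → (∀ n, Integrable (fun ω => g n (W₀ ω)) P) →
        (∀ e n m, |g n e - g m e| ≤ Λ * dist (x n) (x m)) → 0 < v →
        ∫⁻ ω, ⨆ n, ‖g n (W₀ ω)‖ₑ ^ 2 ∂P ≤ ENNReal.ofReal v →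
        eLpNorm (fun ω => ⨆ n, ‖1 / (N : ℝ) * ∑ k ∈ Finset.range N, g n (W k ω) -
            ∫ ω, g n (W₀ ω) ∂P‖ₑ) 2 P ≤ ENNReal.ofReal (√(C * (v ^ κ + v)) / √N) := by
  obtain ⟨C, hC, hmain⟩ := exists_lintegral_iSup_centered_le d D Λ θ κ hΛ hθ hκ hsum
  refine ⟨C, hC, ?_⟩
  intro x hx E _ Ω _ P _ N W W₀ g v hN hind hid hg hgi hLip hv hvar
  have hW₀ : AEMeasurable W₀ P := (hid 0 (by omega)).aemeasurable_snd
  have hW : ∀ k : Fin N, AEMeasurable (W k) P := fun k => (hid k k.2).aemeasurable_fst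
  set ν := P.map W₀ with hν
  have : IsProbabilityMeasure ν := Measure.isProbabilityMeasure_map hW₀
  have hmap : P.map (fun ω (k : Fin N) => W k ω) = Measure.pi fun _ : Fin N => ν := by
    rw [(iIndepFun_iff_map_fun_eq_pi_map hW).1 hind]
    congr 1
    funext k
    exact (hid k k.2).map_eq
  have hint : ∀ n, ∫ e, g n e ∂ν = ∫ ω, g n (W₀ ω) ∂P := fun n =>
    integral_map hW₀ (hg n).aestronglyMeasurable
  have hmeas : Measurable fun e => ⨆ n, ‖g n e‖ₑ ^ 2 :=
    Measurable.iSup fun n => by have := hg n; fun_prop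
  have key := hmain x hx E ν N g v hg
    (fun n => (integrable_map_measure (hg n).aestronglyMeasurable hW₀).2 (hgi n)) hLip hv
    (by rw [hν, lintegral_map' hmeas.aemeasurable hW₀]; exact hvar)
  simp_rw [hint] at key
  rw [← hmap, lintegral_map' (by
    refine (Measurable.iSup fun n => ?_).aemeasurable
    have := hg n
    fun_prop) (aemeasurable_pi_lambda _ hW)] at key
  have hN0 : (0 : ℝ) < N := by exact_mod_cast hN
  have hpt : ∀ ω, (⨆ n, ‖1 / (N : ℝ) * ∑ k ∈ Finset.range N, g n (W k ω) -
      ∫ ω, g n (W₀ ω) ∂P‖ₑ) ^ 2 = ENNReal.ofReal (1 / (N : ℝ) ^ 2) *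
        ⨆ n, ‖∑ k : Fin N, (g n (W k ω) - ∫ ω, g n (W₀ ω) ∂P)‖ₑ ^ 2 := by
    intro ω
    rw [ENNReal.iSup_pow, ENNReal.mul_iSup]
    refine iSup_congr fun n => ?_
    have h1 : 1 / (N : ℝ) * ∑ k ∈ Finset.range N, g n (W k ω) - ∫ ω, g n (W₀ ω) ∂P =
        1 / (N : ℝ) * ∑ k : Fin N, (g n (W k ω) - ∫ ω, g n (W₀ ω) ∂P) := by
      rw [Finset.sum_sub_distrib, Fin.sum_univ_eq_sum_range (fun k => g n (W k ω)),
        Finset.sum_const, Finset.card_univ, Fintype.card_fin, nsmul_eq_mul]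
      field_simp
    rw [h1, enorm_mul, mul_pow, Real.enorm_eq_ofReal_abs (1 / (N : ℝ)),
      ← ENNReal.ofReal_pow (abs_nonneg _), sq_abs, one_div_pow]
  have hsq : eLpNorm (fun ω => ⨆ n, ‖1 / (N : ℝ) * ∑ k ∈ Finset.range N, g n (W k ω) -
      ∫ ω, g n (W₀ ω) ∂P‖ₑ) 2 P ^ 2 ≤ ENNReal.ofReal (√(C * (v ^ κ + v)) / √N) ^ 2 := by
    have h2 := eLpNorm_nnreal_pow_eq_lintegral (f := fun ω => ⨆ n, ‖1 / (N : ℝ) *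
      ∑ k ∈ Finset.range N, g n (W k ω) - ∫ ω, g n (W₀ ω) ∂P‖ₑ) (μ := P) (p := 2) two_ne_zero
    simp only [NNReal.coe_ofNat, ENNReal.rpow_ofNat, ENNReal.coe_ofNat, enorm_eq_self] at h2
    rw [h2]
    simp_rw [hpt]
    rw [lintegral_const_mul' _ _ ENNReal.ofReal_ne_top, ← ENNReal.ofReal_pow (by positivity),
      div_pow, Real.sq_sqrt (by positivity), Real.sq_sqrt hN0.le]
    calc _ ≤ ENNReal.ofReal (1 / (N : ℝ) ^ 2) * ENNReal.ofReal (N * (C * (v ^ κ + v))) := by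
          gcongr
      _ = _ := by
          rw [← ENNReal.ofReal_mul (by positivity)]
          congr 1
          field_simp
  exact (ENNReal.pow_le_pow_left_iff two_ne_zero).1 hsq

/-! ### Costs, increments and infima over dense sequences -/

lemma iInf_eq_iInf_comp_denseRange {S : Type*} [TopologicalSpace S] {φ : S → ℝ}
    (hφ : Continuous φ) {u : ℕ → S} (hu : DenseRange u) : ⨅ x, φ x = ⨅ n, φ (u n) := by
  rw [← Dense.ciInf' hu hφ]
  exact (iInf_range' φ u)

lemma enorm_iInf_sub_iInf_le {a b : ℕ → ℝ} {M : ℝ≥0∞} (ha : BddBelow (Set.range a))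
    (hb : BddBelow (Set.range b)) (hM : ∀ n, ‖a n - b n‖ₑ ≤ M) :
    ‖(⨅ n, a n) - ⨅ n, b n‖ₑ ≤ M := by
  rcases eq_or_ne M ∞ with rfl | hfin
  · exact le_top
  have h : ∀ n, |a n - b n| ≤ M.toReal := by
    intro n
    have := hM n
    rwa [Real.enorm_eq_ofReal_abs, ENNReal.ofReal_le_iff_le_toReal hfin] at this
  rw [Real.enorm_eq_ofReal_abs, ENNReal.ofReal_le_iff_le_toReal hfin, abs_le]
  constructor
  · have : (⨅ n, b n) - M.toReal ≤ ⨅ n, a n := le_ciInf fun n => by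
      have h1 := ciInf_le hb n
      have h2 := (abs_le.1 (h n)).1
      linarith
    linarith
  · have : (⨅ n, a n) - M.toReal ≤ ⨅ n, b n := le_ciInf fun n => by
      have h1 := ciInf_le ha n
      have h2 := (abs_le.1 (h n)).2
      linarith
    linarith

section Cost

variable {d : ℕ} {Θ Ω : Type*} {X : Set (Dec d)} {f : Dec d → Θ → ℝ} {Lf : ℝ}

lemma LipschitzCost.continuous (h : LipschitzCost X f Lf) (z : Θ) :
    Continuous fun x : X => f x z :=
  (LipschitzWith.of_dist_le' (K := Lf) fun x y => by
    rw [Real.dist_eq, Subtype.dist_eq, dist_eq_norm]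
    exact h z x x.2 y y.2).continuous

lemma LipschitzCost.continuous_increment (h : LipschitzCost X f Lf) (ℓ : ℕ) (p : Θ × Θ) :
    Continuous fun x : X => increment f ℓ x p := by
  unfold increment
  split_ifs
  · exact (h.continuous _).sub continuous_const
  · exact (h.continuous _).sub (h.continuous _)

lemma LipschitzCost.continuous_mlmcObjective (h : LipschitzCost X f Lf) (L : ℕ) (N : ℕ → ℕ)
    (Z : ℕ → ℕ → Ω → Θ × Θ) (ω : Ω) : Continuous fun x : X => mlmcObjective f L N Z x ω := by
  unfold mlmcObjective
  exact continuous_finsetSum _ fun ℓ _ => continuous_const.mul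
    (continuous_finsetSum _ fun k _ => h.continuous_increment ℓ _)

lemma LipschitzCost.continuous_expectedCost [MeasurableSpace Ω] {P : Measure Ω}
    [IsProbabilityMeasure P] {ζ : Ω → Θ} (h : LipschitzCost X f Lf)
    (hint : ∀ x ∈ X, Integrable (fun ω => f x (ζ ω)) P) :
    Continuous fun x : X => expectedCost P f ζ x :=
  (LipschitzWith.of_dist_le' (K := Lf) fun x y => by
    rw [Real.dist_eq, Subtype.dist_eq, dist_eq_norm]
    unfold expectedCost
    rw [← integral_sub (hint x x.2) (hint y y.2), ← Real.norm_eq_abs]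
    have := norm_integral_le_of_norm_le_const (μ := P)
      (f := fun ω => f x (ζ ω) - f y (ζ ω)) (C := Lf * ‖(x : Dec d) - y‖)
      (.of_forall fun ω => h (ζ ω) x x.2 y y.2)
    simpa using this).continuous

lemma LipschitzCost.abs_increment_sub_le (h : LipschitzCost X f Lf) (ℓ : ℕ) (p : Θ × Θ)
    {x y : Dec d} (hx : x ∈ X) (hy : y ∈ X) :
    |increment f ℓ x p - increment f ℓ y p| ≤ 2 * |Lf| * dist x y := by
  have h1 : ∀ z, |f x z - f y z| ≤ |Lf| * dist x y := fun z => by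
    rw [dist_eq_norm]
    exact (h z x hx y hy).trans (by gcongr; exact le_abs_self _)
  have h0 : 0 ≤ |Lf| * dist x y := by positivity
  unfold increment
  split_ifs
  · have := h1 p.1
    rw [sub_zero, sub_zero]
    linarith
  · have h2 := abs_sub (f x p.1 - f y p.1) (f x p.2 - f y p.2)
    have h3 := h1 p.1
    have h4 := h1 p.2
    rw [show f x p.1 - f x p.2 - (f y p.1 - f y p.2) =
      f x p.1 - f y p.1 - (f x p.2 - f y p.2) by ring]
    linarith

lemma measurable_increment [MeasurableSpace Θ] (ℓ : ℕ) {x : Dec d} (hx : Measurable (f x)) :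
    Measurable (increment f ℓ x) := by
  unfold increment
  split_ifs <;> fun_prop

/-- The increments telescope to the cost at the finest level. -/
lemma sum_increment (L : ℕ) (x : Dec d) (z : ℕ → Θ) :
    ∑ ℓ ∈ Finset.range (L + 1), increment f ℓ x (z ℓ, z (ℓ - 1)) = f x (z L) := by
  induction L with
  | zero => simp [increment]
  | succ L ih =>
    rw [Finset.sum_range_succ, ih]
    simp [increment]

lemma integrable_increment [MeasurableSpace Θ] [MeasurableSpace Ω] {P : Measure Ω}
    [IsProbabilityMeasure P] {ζs : ℕ → Ω → Θ} {ℓ : ℕ}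
    (hf : ∀ x ∈ X, Measurable (f x)) (hζ : Measurable (ζs ℓ)) (hζ' : Measurable (ζs (ℓ - 1)))
    (hvar : levelVariance P X f ζs ℓ ≠ ∞) {x : Dec d} (hx : x ∈ X) :
    Integrable (fun ω => increment f ℓ x (ζs ℓ ω, ζs (ℓ - 1) ω)) P := by
  have hm : Measurable fun ω => increment f ℓ x (ζs ℓ ω, ζs (ℓ - 1) ω) :=
    (measurable_increment ℓ (hf x hx)).comp (hζ.prodMk hζ')
  refine MemLp.integrable (q := 2) (by norm_num) ⟨hm.aestronglyMeasurable, ?_⟩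
  rw [eLpNorm_lt_top_iff_lintegral_rpow_enorm_lt_top two_ne_zero ENNReal.ofNat_ne_top]
  refine lt_of_le_of_lt ?_ hvar.lt_top
  refine lintegral_mono fun ω => ?_
  simp only [ENNReal.toReal_ofNat, ENNReal.rpow_ofNat]
  exact le_iSup (fun x : X => ‖increment f ℓ x (ζs ℓ ω, ζs (ℓ - 1) ω)‖ₑ ^ 2) ⟨x, hx⟩

/-- The uniform error of the sample average of the level-`ℓ` increments over the points `x n`,
with values in `[0, ∞]` so that the supremum needs no boundedness. -/
noncomputable def levelError [MeasurableSpace Ω] (P : Measure Ω) (f : Dec d → Θ → ℝ)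
    (ζs : ℕ → Ω → Θ) (N : ℕ → ℕ) (Z : ℕ → ℕ → Ω → Θ × Θ) (x : ℕ → Dec d) (ℓ : ℕ) (ω : Ω) : ℝ≥0∞ :=
  ⨆ n, ‖1 / (N ℓ : ℝ) * ∑ k ∈ Finset.range (N ℓ), increment f ℓ (x n) (Z ℓ k ω) -
    ∫ ω, increment f ℓ (x n) (ζs ℓ ω, ζs (ℓ - 1) ω) ∂P‖ₑ

end Cost

/-! ### The sampling error on one level and the total error -/

/-- Root-mean-square bound for the uniform sampling error on one level, in terms of any positive
bound `v` for the level variance. -/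
lemma exists_eLpNorm_levelError_le (d : ℕ) (D Lf θ κ : ℝ) (hθ : 0 < θ) (hκ : 0 < κ)
    (hsum : θ + κ = 1) :
    ∃ C : ℝ, 0 < C ∧
      ∀ (Θ : Type*) [MeasurableSpace Θ] (Ω : Type*) [MeasurableSpace Ω]
        (P : Measure Ω) [IsProbabilityMeasure P] (X : Set (Dec d)) (f : Dec d → Θ → ℝ)
        (ζs : ℕ → Ω → Θ) (L : ℕ) (N : ℕ → ℕ) (Z : ℕ → ℕ → Ω → Θ × Θ) (x : ℕ → Dec d) (ℓ : ℕ)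
        (v : ℝ),
        (∀ n, x n ∈ X) → (∀ n m, dist (x n) (x m) ≤ D) → (∀ x ∈ X, Measurable (f x)) →
        (∀ ℓ ≤ L, Measurable (ζs ℓ)) → LipschitzCost X f Lf → ℓ ≤ L → 1 ≤ N ℓ →
        IsMLMCSample P ζs L N Z → 0 < v → levelVariance P X f ζs ℓ ≤ ENNReal.ofReal v →
        eLpNorm (levelError P f ζs N Z x ℓ) 2 P ≤
          ENNReal.ofReal (√(C * (v ^ κ + v)) / √(N ℓ)) := by
  obtain ⟨C, hC, hmain⟩ := exists_eLpNorm_iSup_average_sub_le d D (2 * |Lf|) θ κ (by positivity)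
    hθ hκ hsum
  refine ⟨C, hC, ?_⟩
  intro Θ _ Ω _ P _ X f ζs L N Z x ℓ v hxX hx hf hζs hLip hℓ hN hZ hv hvar
  have hint : ∀ n, Integrable (fun ω => increment f ℓ (x n) (ζs ℓ ω, ζs (ℓ - 1) ω)) P := fun n =>
    integrable_increment hf (hζs ℓ hℓ) (hζs _ (by omega))
      (ne_top_of_le_ne_top ENNReal.ofReal_ne_top hvar) (hxX n)
  have hvar' : ∫⁻ ω, ⨆ n, ‖increment f ℓ (x n) (ζs ℓ ω, ζs (ℓ - 1) ω)‖ₑ ^ 2 ∂P ≤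
      ENNReal.ofReal v := by
    refine le_trans (lintegral_mono fun ω => iSup_le fun n => ?_) hvar
    exact le_iSup (fun x : X => ‖increment f ℓ x (ζs ℓ ω, ζs (ℓ - 1) ω)‖ₑ ^ 2) ⟨x n, hxX n⟩
  unfold levelError
  rcases Nat.eq_zero_or_pos ℓ with rfl | hpos
  · -- on level `0` only the first components of the samples are known to be i.i.d.
    have h0 : ∀ (y : Dec d) (p : Θ × Θ), increment f 0 y p = f y p.1 := by simp [increment]
    simp only [h0] at hint hvar' ⊢
    refine hmain x hx Θ Ω P (N 0) (fun k ω => (Z 0 k ω).1) (ζs 0) (fun n => f (x n)) v hN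
      hZ.indep_zero hZ.law_zero (fun n => hf _ (hxX n)) hint (fun e n m => ?_) hv hvar'
    simpa only [h0] using hLip.abs_increment_sub_le 0 (e, e) (hxX n) (hxX m)
  · exact hmain x hx (Θ × Θ) Ω P (N ℓ) (Z ℓ) (fun ω => (ζs ℓ ω, ζs (ℓ - 1) ω))
      (fun n => increment f ℓ (x n)) v hN (hZ.indep ℓ hpos hℓ) (hZ.law ℓ hpos hℓ)
      (fun n => measurable_increment ℓ (hf _ (hxX n))) hint
      (fun e n m => hLip.abs_increment_sub_le ℓ e (hxX n) (hxX m)) hv hvar'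

end MLMCSAA

open MLMCSAA

theorem theorem6 (d : ℕ) (D Lf a c₂ β H : ℝ) (ha : 0 < a) (hc₂ : 0 ≤ c₂) (hβ : 0 < β) :
    ∃ c : ℝ, 0 < c ∧
      ∀ (Θ : Type*) [MeasurableSpace Θ] (Ω : Type*) [MeasurableSpace Ω]
        (P : Measure Ω) [IsProbabilityMeasure P]
        (X : Set (MLMCSAA.Dec d)) (f : MLMCSAA.Dec d → Θ → ℝ)
        (ζ : Ω → Θ) (ζs : ℕ → Ω → Θ) (h : ℕ → ℝ) (c₁ α : ℝ)
        (L : ℕ) (N : ℕ → ℕ) (Z : ℕ → ℕ → Ω → Θ × Θ),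
        IsCompact X → X.Nonempty → Metric.diam X ≤ D →
        (∀ x ∈ X, Measurable (f x)) →
        Measurable ζ → (∀ ℓ ≤ L, Measurable (ζs ℓ)) →
        (∀ x ∈ X, Integrable (fun ω => f x (ζ ω)) P) →
        (∀ ℓ ≤ L, 0 < h ℓ ∧ h ℓ ≤ H) →
        0 < α →
        MLMCSAA.LipschitzCost X f Lf →
        (∀ ℓ ≤ L, MLMCSAA.BiasBound P X f ζ ζs ℓ (c₁ * h ℓ ^ α)) →
        (∀ ℓ ≤ L, MLMCSAA.levelVariance P X f ζs ℓ ≤ ENNReal.ofReal (c₂ * h ℓ ^ β)) →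
        2 ≤ L →
        (∀ ℓ ≤ L, 1 ≤ N ℓ) →
        MLMCSAA.IsMLMCSample P ζs L N Z →
        MemLp (fun ω => MLMCSAA.mlmcOptimalValue X f L N Z ω - MLMCSAA.optimalValue P X f ζ) 2 P ∧
        eLpNorm (fun ω => MLMCSAA.mlmcOptimalValue X f L N Z ω - MLMCSAA.optimalValue P X f ζ) 2 P
          ≤ ENNReal.ofReal (c₁ * h L ^ α + 2 * c₂ * c *
              ∑ ℓ ∈ Finset.range (L + 1), h ℓ ^ (β / (1 + a) / 2) / √(N ℓ : ℝ)) := by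
  set κ : ℝ := 1 / (1 + a) with hκdef
  have hκ : 0 < κ := by positivity
  have hθ : 0 < a / (1 + a) := by positivity
  have hsum : a / (1 + a) + κ = 1 := by rw [hκdef]; field_simp; ring
  have hκ1 : κ < 1 := by linarith
  have hβκ : β / (1 + a) = β * κ := by rw [hκdef]; ring
  obtain ⟨C, hC, hlevel⟩ := exists_eLpNorm_levelError_le d D Lf (a / (1 + a)) κ hθ hκ hsum
  set B : ℝ := √(C * (c₂ ^ κ + c₂ * |H| ^ (β * (1 - κ)))) with hB
  have hB0 : 0 ≤ B := Real.sqrt_nonneg _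
  -- for `c₂ = 0` the sampling error vanishes and any positive constant will do
  refine ⟨if c₂ = 0 then 1 else (B + 1) / (2 * c₂), ?_, ?_⟩
  · split_ifs with h0
    · exact one_pos
    · have := lt_of_le_of_ne hc₂ (Ne.symm h0)
      positivity
  set c : ℝ := if c₂ = 0 then 1 else (B + 1) / (2 * c₂) with hc
  intro Θ _ Ω _ P _ X f ζ ζs h c₁ α L N Z hXc hXne hXD hf hζ hζs hint hh hα hLip hbias hvar hL hN hZ
  have hc0 : 0 ≤ 2 * c₂ * c := by
    rw [hc]
    split_ifs with h0
    · positivity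
    · have := lt_of_le_of_ne hc₂ (Ne.symm h0)
      positivity
  have : Nonempty X := hXne.to_subtype
  have : CompactSpace X := isCompact_iff_compactSpace.1 hXc
  set u : ℕ → X := TopologicalSpace.denseSeq X with hu
  have hud : DenseRange u := TopologicalSpace.denseRange_denseSeq X
  have hxd : ∀ n m, dist (u n : Dec d) (u m) ≤ D := fun n m =>
    (Metric.dist_le_diam_of_mem hXc.isBounded (u n).2 (u m).2).trans hXD
  -- the sampling error on each level
  have herr : ∀ ℓ ≤ L, eLpNorm (levelError P f ζs N Z (fun n => u n) ℓ) 2 P ≤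
      ENNReal.ofReal (2 * c₂ * c * (h ℓ ^ (β / (1 + a) / 2) / √(N ℓ : ℝ))) := by
    intro ℓ hℓ
    have hv : ∀ v : ℝ, 0 < v → c₂ * h ℓ ^ β ≤ v →
        eLpNorm (levelError P f ζs N Z (fun n => u n) ℓ) 2 P ≤
          ENNReal.ofReal (√(C * (v ^ κ + v)) / √(N ℓ)) := fun v hv0 hv =>
      hlevel Θ Ω P X f ζs L N Z (fun n => u n) ℓ v (fun n => (u n).2) hxd hf hζs hLip hℓ
        (hN ℓ hℓ) hZ hv0 ((hvar ℓ hℓ).trans (ENNReal.ofReal_le_ofReal hv))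
    have hhpos := (hh ℓ hℓ).1
    rcases hc₂.eq_or_lt with h0 | hpos
    · -- here every `v > 0` is admissible, and `v → 0`
      have hlim : Filter.Tendsto (fun v : ℝ => ENNReal.ofReal (√(C * (v ^ κ + v)) / √(N ℓ)))
          (nhdsWithin 0 (Set.Ioi 0)) (nhds 0) := by
        have hcont : Continuous fun v : ℝ => ENNReal.ofReal (√(C * (v ^ κ + v)) / √(N ℓ)) := by
          have := Real.continuous_rpow_const hκ.le
          exact ENNReal.continuous_ofReal.comp (by fun_prop)
        have := (hcont.tendsto 0).mono_left (nhdsWithin_le_nhds (s := Set.Ioi (0 : ℝ)))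
        simpa [Real.zero_rpow hκ.ne'] using this
      rw [← h0]
      simp only [mul_zero, zero_mul, ENNReal.ofReal_zero]
      refine ge_of_tendsto hlim ?_
      filter_upwards [self_mem_nhdsWithin] with v hv0
      exact hv v hv0 (by rw [← h0, zero_mul]; exact (Set.mem_Ioi.1 hv0).le)
    · refine (hv _ (by positivity) le_rfl).trans (ENNReal.ofReal_le_ofReal ?_)
      have hcB : 2 * c₂ * c = B + 1 := by
        rw [hc, if_neg hpos.ne']; field_simp
      rw [hcB, ← mul_div_assoc]
      refine div_le_div_of_nonneg_right ?_ (Real.sqrt_nonneg _)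
      have hsplit : h ℓ ^ β ≤ |H| ^ (β * (1 - κ)) * h ℓ ^ (β * κ) := by
        calc h ℓ ^ β = h ℓ ^ (β * (1 - κ)) * h ℓ ^ (β * κ) := by
              rw [← Real.rpow_add hhpos]; congr 1; ring
          _ ≤ _ := by
              have h1 : 0 ≤ β * (1 - κ) := mul_nonneg hβ.le (by linarith)
              have h2 : h ℓ ≤ |H| := (hh ℓ hℓ).2.trans (le_abs_self H)
              gcongr
      have hpow : C * ((c₂ * h ℓ ^ β) ^ κ + c₂ * h ℓ ^ β) ≤
          C * (c₂ ^ κ + c₂ * |H| ^ (β * (1 - κ))) * h ℓ ^ (β * κ) := by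
        rw [Real.mul_rpow hc₂ (by positivity), ← Real.rpow_mul hhpos.le, mul_assoc C, add_mul,
          mul_assoc c₂]
        gcongr
      have hroot : √(h ℓ ^ (β * κ)) = h ℓ ^ (β / (1 + a) / 2) := by
        rw [Real.sqrt_eq_rpow, ← Real.rpow_mul hhpos.le, hβκ]
        congr 1
        ring
      calc √(C * ((c₂ * h ℓ ^ β) ^ κ + c₂ * h ℓ ^ β)) ≤ B * h ℓ ^ (β / (1 + a) / 2) := by
            rw [hB, ← hroot, ← Real.sqrt_mul (by positivity)]
            exact Real.sqrt_le_sqrt hpow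
        _ ≤ _ := by gcongr; linarith
  have hZm : ∀ ℓ ≤ L, ∀ k < N ℓ, ∀ n, AEMeasurable (fun ω => increment f ℓ (u n) (Z ℓ k ω)) P := by
    intro ℓ hℓ k hk n
    have hfn := hf _ (u n).2
    rcases Nat.eq_zero_or_pos ℓ with rfl | hpos
    · simp only [increment, if_true, sub_zero]
      exact hfn.comp_aemeasurable (hZ.law_zero k hk).aemeasurable_fst
    · exact (measurable_increment ℓ hfn).comp_aemeasurable (hZ.law ℓ hpos hℓ k hk).aemeasurable_fst
  have hobj : ∀ ω, mlmcOptimalValue X f L N Z ω = ⨅ n, mlmcObjective f L N Z (u n) ω := fun ω =>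
    iInf_eq_iInf_comp_denseRange (hLip.continuous_mlmcObjective L N Z ω) hud
  have hopt : optimalValue P X f ζ = ⨅ n, expectedCost P f ζ (u n) :=
    iInf_eq_iInf_comp_denseRange (hLip.continuous_expectedCost hint) hud
  have hmeas : AEStronglyMeasurable
      (fun ω => mlmcOptimalValue X f L N Z ω - optimalValue P X f ζ) P := by
    simp_rw [hobj]
    refine ((AEMeasurable.iInf fun n => ?_).sub_const _).aestronglyMeasurable
    unfold mlmcObjective
    refine Finset.aemeasurable_fun_sum _ fun ℓ hℓ => AEMeasurable.const_mul
      (Finset.aemeasurable_fun_sum _ fun k hk => ?_) _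
    exact hZm ℓ (by simpa [Nat.lt_succ_iff] using hℓ) k (by simpa using hk) n
  have hTm : ∀ ℓ ≤ L, AEMeasurable (levelError P f ζs N Z (fun n => u n) ℓ) P := by
    intro ℓ hℓ
    refine AEMeasurable.iSup fun n => AEMeasurable.enorm (AEMeasurable.sub_const
      (AEMeasurable.const_mul (Finset.aemeasurable_fun_sum _ fun k hk => ?_) _) _)
    exact hZm ℓ hℓ k (by simpa using hk) n
  set b : ℝ := c₁ * h L ^ α with hb
  have hb0 : 0 ≤ b := (abs_nonneg _).trans (hbias L le_rfl (u 0) (u 0).2)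
  have hinc : ∀ ℓ ∈ Finset.range (L + 1), ∀ n,
      Integrable (fun ω => increment f ℓ (u n) (ζs ℓ ω, ζs (ℓ - 1) ω)) P := by
    intro ℓ hℓ n
    have hℓ' : ℓ ≤ L := by simpa [Nat.lt_succ_iff] using hℓ
    exact integrable_increment hf (hζs ℓ hℓ') (hζs _ (by omega))
      (ne_top_of_le_ne_top ENNReal.ofReal_ne_top (hvar ℓ hℓ')) (u n).2
  -- at every point the total error is the sum of the sampling errors and the bias at level `L`
  have hpoint : ∀ ω n, ‖mlmcObjective f L N Z (u n) ω - expectedCost P f ζ (u n)‖ₑ ≤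
      ENNReal.ofReal b +
        ∑ ℓ ∈ Finset.range (L + 1), levelError P f ζs N Z (fun n => u n) ℓ ω := by
    intro ω n
    have hfL : ∫ ω, f (u n) (ζs L ω) ∂P = ∑ ℓ ∈ Finset.range (L + 1),
        ∫ ω, increment f ℓ (u n) (ζs ℓ ω, ζs (ℓ - 1) ω) ∂P := by
      rw [← integral_finsetSum _ fun ℓ hℓ => hinc ℓ hℓ n]
      exact integral_congr_ae (.of_forall fun ω =>
        (sum_increment (f := f) L (u n) fun ℓ => ζs ℓ ω).symm)
    have hfLi : Integrable (fun ω => f (u n) (ζs L ω)) P := by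
      refine (integrable_finsetSum _ fun ℓ hℓ => hinc ℓ hℓ n).congr (.of_forall fun ω => ?_)
      exact sum_increment (f := f) L (u n) fun ℓ => ζs ℓ ω
    have hdecomp : mlmcObjective f L N Z (u n) ω - expectedCost P f ζ (u n) =
        (∫ ω, (f (u n) (ζs L ω) - f (u n) (ζ ω)) ∂P) + ∑ ℓ ∈ Finset.range (L + 1),
          (1 / (N ℓ : ℝ) * ∑ k ∈ Finset.range (N ℓ), increment f ℓ (u n) (Z ℓ k ω) -
            ∫ ω, increment f ℓ (u n) (ζs ℓ ω, ζs (ℓ - 1) ω) ∂P) := by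
      rw [integral_sub hfLi (hint _ (u n).2), hfL, Finset.sum_sub_distrib]
      unfold mlmcObjective expectedCost
      ring
    rw [hdecomp]
    refine (enorm_add_le _ _).trans (add_le_add ?_ ((enorm_sum_le _ _).trans
      (Finset.sum_le_sum fun ℓ _ => ?_)))
    · rw [Real.enorm_eq_ofReal_abs]
      exact ENNReal.ofReal_le_ofReal (hbias L le_rfl (u n) (u n).2)
    · exact le_iSup (fun n => ‖1 / (N ℓ : ℝ) * ∑ k ∈ Finset.range (N ℓ),
        increment f ℓ (u n) (Z ℓ k ω) -
          ∫ ω, increment f ℓ (u n) (ζs ℓ ω, ζs (ℓ - 1) ω) ∂P‖ₑ) n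
  have hbdd : ∀ {φ : X → ℝ}, Continuous φ → BddBelow (Set.range fun n => φ (u n)) := fun hφ =>
    (isCompact_range hφ).bddBelow.mono (Set.range_comp_subset_range u _)
  have hvalue : ∀ ω, ‖mlmcOptimalValue X f L N Z ω - optimalValue P X f ζ‖ₑ ≤
      ‖ENNReal.ofReal b +
        ∑ ℓ ∈ Finset.range (L + 1), levelError P f ζs N Z (fun n => u n) ℓ ω‖ₑ := by
    intro ω
    rw [hobj, hopt, enorm_eq_self]
    exact enorm_iInf_sub_iInf_le (hbdd (hLip.continuous_mlmcObjective L N Z ω))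
      (hbdd (hLip.continuous_expectedCost hint)) (hpoint ω)
  have hmain : eLpNorm (fun ω => mlmcOptimalValue X f L N Z ω - optimalValue P X f ζ) 2 P ≤
      ENNReal.ofReal (b + 2 * c₂ * c *
        ∑ ℓ ∈ Finset.range (L + 1), h ℓ ^ (β / (1 + a) / 2) / √(N ℓ : ℝ)) := by
    have hTs : ∀ ℓ ∈ Finset.range (L + 1),
        AEStronglyMeasurable (levelError P f ζs N Z (fun n => u n) ℓ) P := fun ℓ hℓ =>
      (hTm ℓ (by simpa [Nat.lt_succ_iff] using hℓ)).aestronglyMeasurable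
    have hterm : ∀ ℓ ∈ Finset.range (L + 1),
        0 ≤ 2 * c₂ * c * (h ℓ ^ (β / (1 + a) / 2) / √(N ℓ : ℝ)) := by
      intro ℓ hℓ
      have := (hh ℓ (by simpa [Nat.lt_succ_iff] using hℓ)).1
      positivity
    calc eLpNorm (fun ω => mlmcOptimalValue X f L N Z ω - optimalValue P X f ζ) 2 P
        ≤ eLpNorm ((fun _ => ENNReal.ofReal b) +
            ∑ ℓ ∈ Finset.range (L + 1), levelError P f ζs N Z (fun n => u n) ℓ) 2 P := by
          refine eLpNorm_mono_enorm fun ω => (hvalue ω).trans (le_of_eq ?_)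
          simp
      _ ≤ eLpNorm (fun _ : Ω => ENNReal.ofReal b) 2 P + ∑ ℓ ∈ Finset.range (L + 1),
            eLpNorm (levelError P f ζs N Z (fun n => u n) ℓ) 2 P :=
          (eLpNorm_add_le aestronglyMeasurable_const
            (Finset.aestronglyMeasurable_sum _ hTs) (by norm_num)).trans
            (by gcongr; exact eLpNorm_sum_le hTs (by norm_num))
      _ ≤ ENNReal.ofReal b + ∑ ℓ ∈ Finset.range (L + 1),
            ENNReal.ofReal (2 * c₂ * c * (h ℓ ^ (β / (1 + a) / 2) / √(N ℓ : ℝ))) := by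
          refine add_le_add (le_of_eq ?_) (Finset.sum_le_sum fun ℓ hℓ =>
            herr ℓ (by simpa [Nat.lt_succ_iff] using hℓ))
          rw [eLpNorm_const' _ two_ne_zero ENNReal.ofNat_ne_top]
          simp
      _ = _ := by
          rw [← ENNReal.ofReal_sum_of_nonneg hterm, Finset.mul_sum,
            ENNReal.ofReal_add hb0 (Finset.sum_nonneg hterm)]
  exact ⟨⟨hmeas, hmain.trans_lt ENNReal.ofReal_lt_top⟩, hmain⟩
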